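/- **Programs.** A rule $r$ is $a_1\vee\dots\vee a_\ell\leftarrow a_{\ell+1},\dots,a_m,\neg a_{m+1},\dots,\neg a_n$ with distinct atoms; $H_r=\{a_1,\dots,a_\ell\}$, $B_r^+=\{a_{\ell+1},\dots,a_m\}$, $B_r^-=\{a_{m+1},\dots,a_n\}$, $\mathrm{at}(r)=H_r\cup B_r^+\cup B_r^-$. A program $\Pi$ is a finite set of rules, $\mathrm{at}(\Pi)=\bigcup_{r\in\Pi}\mathrm{at}(r)$. A set $I$ of atoms satisfies $r$ if $(H_r\cup B_r^-)\cap I\ne\emptyset$ or $B_r^+\setminus I\neq\emptyset$; it is a model of $\Pi$ ($I\models\Pi$) if it satisfies all rules of $\Pi$; it is an answer set of $\Pi$ if it is a $\subseteq$-minimal model of the Gelfond–Lifschitz reduct $\Pi^I=\{H_r\leftarrow B_r^+ : r\in\Pi,\ B_r^-\cap I=\emptyset\}$. $\Pi$ is head-cycle-free if no directed cycle (closed walk) of the digraph with the arcs $(a,b)$, $a\in B^+_r$, $b\in H_r$, $r\in\Pi$, contains two distinct atoms of the head of one rule. The primal graph $G_\Pi$ has vertex set $\mathrm{at}(\Pi)$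 and an edge between any two distinct atoms that occur in a common rule. **Tree decompositions.** A tree decomposition $(T,\chi)$ of $G_\Pi$ consists of a rooted tree $T$ with root $n$, in which the children of each node are listed in a fixed order, and bags $\chi(t)\subseteq\mathrm{at}(\Pi)$ that cover all vertices and all edges and satisfy $\chi(r)\cap\chi(t)\subseteq\chi(s)$ whenever $s$ lies on the path from $r$ to $t$. It is nice if the bags of the root and of all leaves are empty and each node $t$ is a leaf; or an introduce node (one child $t'$, $\chi(t')\subseteq\chi(t)$, $|\chi(t)|=|\chi(t')|+1$); or a removal node (one child $t'$, $\chi(t)\subseteq\chi(t')$, $|\chi(t')|=|\chi(t)|+1$); or a join node (two children $t',t''$, $\chi(t)=\chi(t')=\chi(t'')\neq\emptyset$). Put $\Pi_t=\{r\in\Pi:\mathrm{at}(r)\subseteq\chi(t)\}$. **Algorithm.** Rows are triples $\langle I,\mathcal P,\sigma\rangle$ of an interpretation $I$, a set $\mathcal P$ of atoms (those already proven) and a sequence $\sigma$ of atoms. Write $b<_\sigma a$ if $b$ occurs before $a$ in $\sigma$. Let $\mathrm{gp}(I,\sigma,\Pi_t)$ be the set of atoms $a$ for which there is $r\in\Pi_t$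 with $a\in H_r$, $B_r^+\subseteq I$, $I\cap B_r^-=\emptyset$, $I\cap(H_r\setminus\{a\})=\emptyset$ and $b<_\sigma a$ for all $b\in B_r^+$. The algorithm $\mathrm{DP}_{\mathrm{PHC}}$ traverses $T$ in post-order and computes at each node $t$ with children $t_1,\dots,t_\ell$ the table $\tau(t)=\mathrm{PHC}(t,\chi(t),\Pi_t,\langle\tau(t_1),\dots,\tau(t_\ell)\rangle)$, where $\mathrm{PHC}$, applied to child tables $\tau_1,\dots,\tau_\ell$, returns - leaf: $\{\langle\emptyset,\emptyset,\langle\rangle\rangle\}$; - introduction of $a$: all $\langle J,\mathcal P\cup\mathrm{gp}(J,\sigma',\Pi_t),\sigma'\rangle$ with $\langle I,\mathcal P,\sigma\rangle\in\tau_1$, $J\in\{I,I\cup\{a\}\}$, $J\models\Pi_t$, where $\sigma'=\sigma$ if $a\notin J$, and $\sigma'$ arises from $\sigma$ by inserting $a$ at any position if $a\in J$; - removal of $a$: all $\langle I\setminus\{a\},\mathcal P\setminus\{a\},\sigma\text{ without }a\rangle$ with $\langle I,\mathcal P,\sigma\rangle\in\tau_1$ and ($a\in\mathcal P$ or $a\notin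 I$); - join: all $\langle I,\mathcal P_1\cup\mathcal P_2,\sigma\rangle$ with $\langle I,\mathcal P_1,\sigma\rangle\in\tau_1$ and $\langle I,\mathcal P_2,\sigma\rangle\in\tau_2$. **Origins, extensions and solutions.** The origins of a row $u$ at $t$ are the sequences $\langle s_1,\dots,s_\ell\rangle\in\tau(t_1)\times\dots\times\tau(t_\ell)$ with $u\in\mathrm{PHC}(t,\chi(t),\Pi_t,\langle\{s_1\},\dots,\{s_\ell\}\rangle)$. The only extension of $u$ below a leaf $t$ is $\{\langle t,u\rangle\}$; the extensions of $u$ below an inner node $t$ are the sets $\{\langle t,u\rangle\}\cup X_1\cup\dots\cup X_\ell$, where $\langle s_1,\dots,s_\ell\rangle$ is an origin of $u$ at $t$ and each $X_i$ is an extension of $s_i$ below $t_i$. The interpretation of an extension is the union of the interpretations $I$ of its rows. Let $\Pi_{\le t}$ be the union of the $\Pi_{t'}$, and $\mathrm{at}_{\le t}$ the union of the $\chi(t')$, over the nodes $t'$ of the subtree rooted at $t$. A PHC-solution up to $t$ is a triple $\langle\hat I,\hat{\mathcal P},\hat\sigma\rangle$ such that $\hat I\subseteq\mathrm{at}_{\le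 t}$, $\hat{\mathcal P}\subseteq\hat I$, $\hat\sigma$ lists every element of $\hat I$ exactly once, $\hat I\models\Pi_{\le t}$, $\hat I\cap(\mathrm{at}_{\le t}\setminus\chi(t))\subseteq\hat{\mathcal P}$, and $\hat{\mathcal P}=\hat I\cap\mathrm{gp}(\hat I,\hat\sigma,\Pi_{\le t})$. **Theorem.** Let $\Pi$ be a head-cycle-free program other than the program whose only rule is the rule $\bot\leftarrow$ without atoms, and let $(T,\chi)$ be a nice tree decomposition of $G_\Pi$ with root $n$. Let $\tau$ be the tables computed by $\mathrm{DP}_{\mathrm{PHC}}$. Then 1. for every node $t$ and every row $\langle I,\mathcal P,\sigma\rangle\in\tau(t)$ we have $I\subseteq\chi(t)$, $\mathcal P\subseteq I$, and $\sigma$ lists every element of $I$ exactly once; 2. $\Pi$ has an answer set if and only if $\langle\emptyset,\emptyset,\langle\rangle\rangle\in\tau(n)$; 3. the set of interpretations of the extensions below $n$ of the rows of $\tau(n)$ equals $\{\hat I:\langle\hat I,\hat{\mathcal P},\hat\sigma\rangle\text{ is a PHC-solution up to }n\}$, and this set equals the set of all answer sets of $\Pi$. -/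

import Mathlib

namespace ASP

/-! Propositional disjunctive programs and their answer sets. -/

/-- A disjunctive rule `a₁ ∨ ⋯ ∨ a_ℓ ← a_{ℓ+1}, …, a_m, ¬ a_{m+1}, …, ¬ a_n` over pairwise
distinct atoms, given by its head, its positive body and its negative body. -/
structure Rule (α : Type*) where
  head : Finset α
  pos : Finset α
  neg : Finset α
  head_pos : Disjoint head pos
  head_neg : Disjoint head neg
  pos_neg : Disjoint pos neg
  deriving DecidableEq

/-- A program is a finite set of rules. -/
abbrev Program (α : Type*) := Finset (Rule α)

section Programs

variable {α : Type*} [DecidableEq α]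

/-- The rule `⊥ ←` without any atom. -/
def Rule.empty : Rule α := ⟨∅, ∅, ∅, by simp, by simp, by simp⟩

/-- Atoms of a rule. -/
def Rule.atoms (r : Rule α) : Finset α := r.head ∪ r.pos ∪ r.neg

/-- Atoms of a program. -/
def Program.atoms (P : Program α) : Finset α := P.biUnion Rule.atoms

/-- The interpretation `I` satisfies the rule `r`. -/
def Rule.Sat (I : Finset α) (r : Rule α) : Prop :=
  (r.head ∪ r.neg) ∩ I ≠ ∅ ∨ r.pos \ I ≠ ∅

instance (I : Finset α) (r : Rule α) : Decidable (r.Sat I) :=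
  inferInstanceAs (Decidable (_ ∨ _))

/-- `I` is a model of `P`. -/
def IsModel (I : Finset α) (P : Program α) : Prop := ∀ r ∈ P, r.Sat I

instance (I : Finset α) (P : Program α) : Decidable (IsModel I P) :=
  inferInstanceAs (Decidable (∀ r ∈ P, r.Sat I))

/-- The rule with its negative body deleted. -/
def Rule.dropNeg (r : Rule α) : Rule α :=
  ⟨r.head, r.pos, ∅, r.head_pos, by simp, by simp⟩

/-- The Gelfond–Lifschitz reduct of `P` under `I`. -/
def Program.reduct (P : Program α) (I : Finset α) : Program α :=
  (P.filter fun r => r.neg ∩ I = ∅).image Rule.dropNeg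

/-- `I` is an answer set of `P`: a subset-minimal model of the reduct of `P` under `I`. -/
def IsAnswerSet (P : Program α) (I : Finset α) : Prop :=
  IsModel I (P.reduct I) ∧ ∀ J, J ⊂ I → ¬ IsModel J (P.reduct I)

/-- Arcs `(a, b)` of the positive dependency digraph. -/
def DepArc (P : Program α) (a b : α) : Prop := ∃ r ∈ P, a ∈ r.pos ∧ b ∈ r.head

/-- No directed cycle of the positive dependency digraph contains two distinct atoms of the head
of one rule. Cycles are closed directed walks, which may repeat vertices. -/
def HeadCycleFree (P : Program α) : Prop :=
  ¬ ∃ r ∈ P, ∃ a ∈ r.head, ∃ b ∈ r.head, a ≠ b ∧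
    ∃ c : Cycle α, c.Chain (DepArc P) ∧ a ∈ c ∧ b ∈ c

/-- `σ` is an ordering of the set `I`: a sequence listing every element of `I` exactly once. -/
def IsOrdering (σ : List α) (I : Finset α) : Prop := σ.Nodup ∧ σ.toFinset = I

/-- `b <_σ a`: `b` occurs before `a` in the sequence `σ`. -/
def Before (σ : List α) (b a : α) : Prop := [b, a].Sublist σ

instance (σ : List α) (b a : α) : Decidable (Before σ b a) :=
  inferInstanceAs (Decidable ([b, a].Sublist σ))

/-- `a ∈ I` is proven using the program `P` and the ordering `σ`. -/
def Proven (P : Program α) (I : Finset α) (σ : List α) (a : α) : Prop :=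
  a ∈ I ∧ ∃ r ∈ P, a ∈ r.head ∧ r.pos ⊆ I ∧ (∀ b ∈ r.pos, Before σ b a) ∧
    I ∩ r.neg = ∅ ∧ I ∩ (r.head \ {a}) = ∅

/-- The primal graph of `P`; its vertex set is `P.atoms`. -/
def primalGraph (P : Program α) : SimpleGraph α where
  Adj a b := a ≠ b ∧ ∃ r ∈ P, a ∈ r.atoms ∧ b ∈ r.atoms
  symm := ⟨fun _ _ ⟨h, r, hr, ha, hb⟩ => ⟨h.symm, r, hr, hb, ha⟩⟩
  loopless := ⟨fun _ h => h.1 rfl⟩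

end Programs

/-! Rooted trees and tree decompositions. -/

/-- A rooted tree with node set `N` in which the children of every node are listed in a fixed
order: the underlying undirected graph is a tree and all arcs point away from the root. -/
structure OrdTree (N : Type*) where
  root : N
  children : N → List N
  nodup_children : ∀ t, (children t).Nodup
  isTree : (SimpleGraph.fromRel fun t t' => t' ∈ children t).IsTree
  dist_child : ∀ t, ∀ t' ∈ children t,
    (SimpleGraph.fromRel fun t t' => t' ∈ children t).dist root t' =
      (SimpleGraph.fromRel fun t t' => t' ∈ children t).dist root t + 1

section Trees

variable {N : Type*}

/-- The underlying undirected graph. -/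
def OrdTree.graph (T : OrdTree N) : SimpleGraph N :=
  SimpleGraph.fromRel fun t t' => t' ∈ T.children t

theorem OrdTree.dist_lt_card [Fintype N] (T : OrdTree N) (t : N) :
    T.graph.dist T.root t < Fintype.card N := by
  obtain ⟨p, hp, hl⟩ := T.isTree.1.exists_path_of_dist T.root t
  have := hp.length_lt
  unfold OrdTree.graph
  omega

/-- The post-order sequence of the nodes of the subtree rooted at `t`. -/
def OrdTree.postOrder [Fintype N] (T : OrdTree N) (t : N) : List N :=
  ((T.children t).attach.flatMap fun c => T.postOrder c.1) ++ [t]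
termination_by Fintype.card N - T.graph.dist T.root t
decreasing_by
  have h1 := T.dist_lt_card c.1
  have h2 := T.dist_child t c.1 c.2
  unfold OrdTree.graph at *
  omega

/-- `(T, χ)` is a tree decomposition of the graph with vertex set `V` and edges as in `G`. -/
structure IsTreeDecomposition {α : Type*} [DecidableEq α] (V : Finset α) (G : SimpleGraph α)
    (T : OrdTree N) (χ : N → Finset α) : Prop where
  bag_subset : ∀ t, χ t ⊆ V
  cover_vertex : ∀ v ∈ V, ∃ t, v ∈ χ t
  cover_edge : ∀ u v, G.Adj u v → ∃ t, u ∈ χ t ∧ v ∈ χ t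
  path : ∀ r s t, ∀ p : T.graph.Walk r t, p.IsPath → s ∈ p.support → χ r ∩ χ t ⊆ χ s

/-- The types of nodes in nice tree decompositions, together with the children of the node. -/
inductive NodeType (N : Type*) where
  | leaf
  | int (t' : N)
  | rem (t' : N)
  | join (t' t'' : N)

/-- The type of the node `t`, if it has one. -/
def nodeType {α : Type*} [DecidableEq α] (T : OrdTree N) (χ : N → Finset α) (t : N) :
    Option (NodeType N) :=
  match T.children t with
  | [] => some .leaf
  | [t'] =>
    if χ t' ⊆ χ t ∧ (χ t).card = (χ t').card + 1 then some (.int t')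
    else if χ t ⊆ χ t' ∧ (χ t').card = (χ t).card + 1 then some (.rem t')
    else none
  | [t', t''] => if χ t = χ t' ∧ χ t = χ t'' ∧ χ t ≠ ∅ then some (.join t' t'') else none
  | _ => none

/-- Every node has a type, and the bags of the root and of all leaves are empty. -/
structure IsNice {α : Type*} [DecidableEq α] (T : OrdTree N) (χ : N → Finset α) : Prop where
  has_type : ∀ t, nodeType T χ t ≠ none
  root_empty : χ T.root = ∅
  leaf_empty : ∀ t, nodeType T χ t = some .leaf → χ t = ∅

end Trees

/-! Dynamic programming on tree decompositions. -/

section DP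

variable {α N : Type*} [DecidableEq α] [Fintype N] [DecidableEq N]

/-- The bag-program of a bag: the rules all of whose atoms are in the bag. -/
def bagProgram (P : Program α) (bag : Finset α) : Program α := P.filter fun r => r.atoms ⊆ bag

/-- The algorithm `DP_A` for a table algorithm `A`, which receives the node, its bag, its
bag-program and the tables of the children. The nodes are visited in post-order. Tables are finite
sets of rows, and initially all tables are empty. -/
def dynProg {R : Type*}
    (A : N → Finset α → Program α → List (Finset R) → Finset R)
    (P : Program α) (T : OrdTree N) (χ : N → Finset α) : N → Finset R :=
  (T.postOrder T.root).foldl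
    (fun o t => Function.update o t (A t (χ t) (bagProgram P (χ t)) ((T.children t).map o)))
    (fun _ => ∅)

/-- Rows `⟨I, 𝒫, σ⟩` of an interpretation, a set of (proven) atoms and a sequence of atoms. -/
abbrev Row (α : Type*) := Finset α × Finset α × List α

/-- The atoms that are proven by a rule of `P` with respect to `I` and `σ`. -/
def gatherProof (I : Finset α) (σ : List α) (P : Program α) : Finset α :=
  P.biUnion fun r => r.head.filter fun a =>
    r.pos ⊆ I ∧ I ∩ r.neg = ∅ ∧ I ∩ (r.head \ {a}) = ∅ ∧ ∀ b ∈ r.pos, Before σ b a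

/-- The sequences that arise from `σ` by inserting one element of `A` (`σ` itself if `A = ∅`). -/
def possOrd (σ : List α) (A : Finset α) : Finset (List α) :=
  (if A = ∅ then {σ} else ∅) ∪
    A.biUnion fun a => (Finset.range (σ.length + 1)).image fun i => σ.insertIdx i a

/-- The table algorithm `PHC`. At introduce and removal nodes, the set over which `a` ranges
consists of the single introduced or removed atom. -/
def PHC (T : OrdTree N) (χ : N → Finset α) (t : N) (bag : Finset α) (Pt : Program α)
    (tabs : List (Finset (Row α))) : Finset (Row α) :=
  match nodeType T χ t, tabs with
  | some .leaf, _ => {(∅, ∅, [])}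
  | some (.int t'), [τ₁] =>
    (bag \ χ t').biUnion fun a =>
      τ₁.biUnion fun (I, Q, σ) =>
        (({I, insert a I} : Finset (Finset α)).filter fun J => IsModel J Pt).biUnion fun J =>
          (possOrd σ ({a} ∩ J)).image fun σ' => (J, Q ∪ gatherProof J σ' Pt, σ')
  | some (.rem t'), [τ₁] =>
    (χ t' \ bag).biUnion fun a =>
      (τ₁.filter fun (I, Q, _) => a ∈ Q ∪ ({a} \ I)).image fun (I, Q, σ) =>
        (I.erase a, Q.erase a, σ.erase a)
  | some (.join _ _), [τ₁, τ₂] =>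
    τ₁.biUnion fun (I, Q₁, σ) =>
      (τ₂.filter fun (I', _, σ') => I' = I ∧ σ' = σ).image fun (_, Q₂, _) => (I, Q₁ ∪ Q₂, σ)
  | _, _ => ∅

/-- The tables computed by `DP_PHC`. -/
def dpPHC (P : Program α) (T : OrdTree N) (χ : N → Finset α) : N → Finset (Row α) :=
  dynProg (PHC T χ) P T χ

/-- The origins of the row `u` in the node `t` with respect to the tables `τ`: sequences of rows,
one from the table of every child, from which `PHC` produces `u`. -/
def origins (P : Program α) (T : OrdTree N) (χ : N → Finset α) (τ : N → Finset (Row α))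
    (t : N) (u : Row α) : Set (Fin (T.children t).length → Row α) :=
  {s | (∀ i, s i ∈ τ ((T.children t).get i)) ∧
    u ∈ PHC T χ t (χ t) (bagProgram P (χ t)) (List.ofFn fun i => {s i})}

/-- `IsExtension P T χ τ t u X`: the set `X` of pairs of nodes and rows is an extension below `t`
of the row `u`, i.e. it is obtained from `u` by transitively following origins to the leaves. -/
inductive IsExtension (P : Program α) (T : OrdTree N) (χ : N → Finset α)
    (τ : N → Finset (Row α)) : N → Row α → Finset (N × Row α) → Prop
  | leaf (t : N) (u : Row α) (ht : T.children t = []) : IsExtension P T χ τ t u {(t, u)}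
  | node (t : N) (u : Row α) (ht : T.children t ≠ [])
      (s : Fin (T.children t).length → Row α) (hs : s ∈ origins P T χ τ t u)
      (X : Fin (T.children t).length → Finset (N × Row α))
      (hX : ∀ i, IsExtension P T χ τ ((T.children t).get i) (s i) (X i)) :
      IsExtension P T χ τ t u ({(t, u)} ∪ Finset.univ.biUnion X)

/-- The extensions below `t` of the rows of a table `ρ`. -/
def extensions (P : Program α) (T : OrdTree N) (χ : N → Finset α) (τ : N → Finset (Row α))
    (t : N) (ρ : Finset (Row α)) : Set (Finset (N × Row α)) :=
  {X | ∃ u ∈ ρ, IsExtension P T χ τ t u X}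

/-- The set of interpretations of a family of extensions. -/
def interpretations (E : Set (Finset (N × Row α))) : Set (Finset α) :=
  {I | ∃ X ∈ E, I = X.biUnion fun p => p.2.1}

/-- The nodes of the subtree rooted at `t`. -/
def below (T : OrdTree N) (t : N) : Finset N := (T.postOrder t).toFinset

/-- The program below `t`. -/
def programBelow (P : Program α) (T : OrdTree N) (χ : N → Finset α) (t : N) : Program α :=
  (below T t).biUnion fun t' => bagProgram P (χ t')

/-- The atoms below `t`. -/
def atomsBelow (T : OrdTree N) (χ : N → Finset α) (t : N) : Finset α := (below T t).biUnion χ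

/-- `⟨I, Q, σ⟩` is a `PHC`-solution up to `t`. -/
structure IsPHCSolution (P : Program α) (T : OrdTree N) (χ : N → Finset α) (t : N)
    (I Q : Finset α) (σ : List α) : Prop where
  subset_atoms : I ⊆ atomsBelow T χ t
  proven_subset : Q ⊆ I
  ordering : IsOrdering σ I
  model : IsModel I (programBelow P T χ t)
  strictly_below : ∀ a ∈ I ∩ (atomsBelow T χ t \ χ t), a ∈ Q
  mem_iff : ∀ a, a ∈ Q ↔ Proven (programBelow P T χ t) I σ a

end DP

end ASP

/-! Two facts carry the theorem. The first removes minimality: for a head-cycle-free program, the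
answer sets are exactly the models `I` that have an ordering in which every atom is proven by a rule
whose positive body comes earlier and whose head meets `I` only in that atom. Such an ordering
forces all of `I` into every model `J ⊆ I` of the reduct (`isAnswerSet_of_proven`). Conversely, an
ordering of an answer set is built greedily. The step is `IsAnswerSet.exists_supported`: among the
atoms not yet listed, consider those in an initial strongly connected component of the dependency
digraph. Deleting them violates some rule of the reduct, and head-cycle-freeness leaves this rule
only one true head atom.

The second fact is locality: satisfaction of a rule, and being proven by it, depend only on the
restriction of interpretation and ordering to the atoms of the rule. In a tree decomposition two
parts share only atoms of a bag, so solutions of a union of programs split into solutions of the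
parts, and solutions that agree on the bag glue together. The orderings are merged by
`exists_merge`. Induction on the tree then identifies the pairs of a row and the interpretation of
one of its extensions with the traces of partial solutions (`mem_and_hasExtension_iff`).

At the root the bag is empty, so every atom has to be proven, and every rule has been seen because
its atoms form a clique. The rule without atoms needs separate treatment: it belongs to the
bag-program of a leaf, where the algorithm checks no rules (`dpPHC_eq_empty`). -/

namespace ASP

/-! ### Rooted trees: parents, subtrees and separation. -/

section Trees

variable {N : Type*}

namespace OrdTree

/-- The arcs from a node to its children. -/
def IsChild (T : OrdTree N) (t t' : N) : Prop := t' ∈ T.children t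

/-- The distance of a node from the root. -/
noncomputable def depth (T : OrdTree N) (t : N) : ℕ := T.graph.dist T.root t

theorem depth_child (T : OrdTree N) {t t' : N} (h : T.IsChild t t') :
    T.depth t' = T.depth t + 1 := T.dist_child t t' h

theorem IsChild.ne {T : OrdTree N} {t t' : N} (h : T.IsChild t t') : t ≠ t' := by
  rintro rfl
  have := T.depth_child h
  omega

theorem IsChild.adj {T : OrdTree N} {t t' : N} (h : T.IsChild t t') : T.graph.Adj t t' :=
  (SimpleGraph.fromRel_adj _ _ _).2 ⟨h.ne, Or.inl h⟩

theorem adj_iff (T : OrdTree N) (s t : N) :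
    T.graph.Adj s t ↔ T.IsChild s t ∨ T.IsChild t s := by
  refine ⟨fun h => ((SimpleGraph.fromRel_adj _ _ _).1 h).2, ?_⟩
  rintro (h | h)
  · exact h.adj
  · exact h.adj.symm

theorem isTree_graph (T : OrdTree N) : T.graph.IsTree := T.isTree

/-- A shortest path from the root to a parent of `t`, prolonged by the arc to `t`, has length equal
to the depth of `t`, so it is again a path. Paths in a tree are unique, and the parent is the
penultimate vertex. -/
theorem IsChild.parent_unique {T : OrdTree N} {p q t : N} (hp : T.IsChild p t)
    (hq : T.IsChild q t) : p = q := by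
  have key : ∀ {p}, T.IsChild p t →
      ∃ w : T.graph.Walk T.root t, w.IsPath ∧ w.penultimate = p := by
    intro p hp
    obtain ⟨w, hw, hl⟩ := T.isTree_graph.1.exists_path_of_dist T.root p
    refine ⟨w.concat hp.adj, ?_, by simp⟩
    apply SimpleGraph.Walk.isPath_of_length_eq_dist
    rw [SimpleGraph.Walk.length_concat, hl]
    exact (T.depth_child hp).symm
  obtain ⟨w, hw, rfl⟩ := key hp
  obtain ⟨v, hv, rfl⟩ := key hq
  have h := (T.isTree_graph.2.subsingleton_path _ _).elim ⟨w, hw⟩ ⟨v, hv⟩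
  exact congrArg (fun p => p.1.penultimate) h

/-- Induction from the leaves to the root. -/
theorem induction [Fintype N] (T : OrdTree N) {C : N → Prop}
    (h : ∀ t, (∀ c ∈ T.children t, C c) → C t) (t : N) : C t := by
  induction hn : Fintype.card N - T.depth t using Nat.strong_induction_on generalizing t with
  | _ n ih =>
    refine h t fun c hc => ih _ ?_ c rfl
    have h1 : T.depth c < Fintype.card N := T.dist_lt_card c
    have h2 := T.depth_child hc
    omega

/-- The node `s` belongs to the subtree rooted at `t`. -/
def IsBelow (T : OrdTree N) (t s : N) : Prop := Relation.ReflTransGen T.IsChild t s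

theorem IsBelow.refl (T : OrdTree N) (t : N) : T.IsBelow t t := Relation.ReflTransGen.refl

theorem IsBelow.depth_le {T : OrdTree N} {t s : N} (h : T.IsBelow t s) :
    T.depth t ≤ T.depth s := by
  induction h with
  | refl => exact le_rfl
  | tail _ hc ih => rw [T.depth_child hc]; omega

/-- The reversed child relation is single-valued, so the ancestors of `s` form a chain. -/
theorem IsBelow.total {T : OrdTree N} {t t' s : N} (h : T.IsBelow t s) (h' : T.IsBelow t' s) :
    T.IsBelow t t' ∨ T.IsBelow t' t := by
  have h1 := Relation.reflTransGen_swap.2 h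
  have h2 := Relation.reflTransGen_swap.2 h'
  have hU : Relator.RightUnique (Function.swap T.IsChild) :=
    fun _ _ _ h h' => IsChild.parent_unique h h'
  have := Relation.ReflTransGen.total_of_right_unique hU h1 h2
  exact this.symm.imp Relation.reflTransGen_swap.1 Relation.reflTransGen_swap.1

theorem not_isBelow_parent {T : OrdTree N} {t t' : N} (h : T.IsChild t t') :
    ¬ T.IsBelow t' t := by
  intro h'
  have := h'.depth_le
  rw [T.depth_child h] at this
  omega

theorem not_isBelow_sibling {T : OrdTree N} {t t₁ t₂ s : N} (h₁ : T.IsChild t t₁)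
    (h₂ : T.IsChild t t₂) (hne : t₁ ≠ t₂) (hs : T.IsBelow t₁ s) : ¬ T.IsBelow t₂ s := by
  have key : ∀ {t₁ t₂}, T.IsChild t t₁ → T.IsChild t t₂ → t₁ ≠ t₂ → ¬ T.IsBelow t₁ t₂ := by
    intro t₁ t₂ h₁ h₂ hne h
    rcases Relation.ReflTransGen.cases_tail h with h | ⟨p, hp, hpt⟩
    · exact hne h.symm
    · rw [hpt.parent_unique h₂] at hp
      exact not_isBelow_parent h₁ hp
  intro hs'
  rcases hs.total hs' with h | h
  · exact key h₁ h₂ hne h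
  · exact key h₂ h₁ hne.symm h

/-- Leaving a subtree is only possible through its root. -/
theorem eq_of_adj_isBelow {T : OrdTree N} {t x y : N} (hx : T.IsBelow t x)
    (hy : ¬ T.IsBelow t y) (h : T.graph.Adj x y) : x = t := by
  rcases (T.adj_iff x y).1 h with h | h
  · exact absurd (Relation.ReflTransGen.tail hx h) hy
  · rcases Relation.ReflTransGen.cases_tail hx with h' | ⟨p, hp, hpx⟩
    · exact h'
    · rw [hpx.parent_unique h] at hp
      exact absurd hp hy

/-- A walk leaving the subtree of the root would have to leave it at the root itself, towards a
parent of the root, which depth forbids. -/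
theorem isBelow_root (T : OrdTree N) (t : N) : T.IsBelow T.root t := by
  by_contra hn
  obtain ⟨w⟩ := T.isTree_graph.1.preconnected T.root t
  obtain ⟨d, -, h1, h2⟩ := w.exists_boundary_dart {s | T.IsBelow T.root s}
    Relation.ReflTransGen.refl hn
  have h3 := eq_of_adj_isBelow h1 h2 d.adj
  rcases (T.adj_iff _ _).1 d.adj with h | h
  · exact h2 (Relation.ReflTransGen.tail h1 h)
  · rw [h3] at h
    have := T.depth_child h
    simp [depth] at this

theorem mem_support_of_isBelow {T : OrdTree N} {t x y : N} (hx : T.IsBelow t x)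
    (hy : ¬ T.IsBelow t y) (w : T.graph.Walk x y) : t ∈ w.support := by
  obtain ⟨d, hd, h1, h2⟩ := w.exists_boundary_dart {s | T.IsBelow t s} hx hy
  rw [← eq_of_adj_isBelow h1 h2 d.adj]
  exact w.dart_fst_mem_support_of_mem_darts hd

/-! ### Post-order traversal as recursion on the children. -/

theorem postOrder_eq [Fintype N] (T : OrdTree N) (t : N) :
    T.postOrder t = (T.children t).flatMap T.postOrder ++ [t] := by
  rw [postOrder]
  congr 1
  exact List.flatMap_subtype (fun _ _ => rfl) |>.trans (by rw [List.unattach_attach])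

theorem mem_postOrder [Fintype N] (T : OrdTree N) (t s : N) :
    s ∈ T.postOrder t ↔ T.IsBelow t s := by
  induction t using T.induction with
  | h t ih =>
    rw [postOrder_eq, List.mem_append, List.mem_flatMap, List.mem_singleton]
    constructor
    · rintro (⟨c, hc, hs⟩ | rfl)
      · exact Relation.ReflTransGen.head hc ((ih c hc).1 hs)
      · exact Relation.ReflTransGen.refl
    · intro h
      rcases Relation.ReflTransGen.cases_head h with h | ⟨c, hc, hs⟩
      · exact Or.inr h.symm
      · exact Or.inl ⟨c, hc, (ih c hc).2 hs⟩

/-- Evaluation of a function on the nodes that is given by recursion on the children. -/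
def eval [Fintype N] {R : Type*} (T : OrdTree N) (F : N → List R → R) (t : N) : R :=
  F t ((T.children t).attach.map fun c => T.eval F c.1)
termination_by Fintype.card N - T.graph.dist T.root t
decreasing_by
  have h1 := T.dist_lt_card c.1
  have h2 := T.dist_child t c.1 c.2
  unfold OrdTree.graph at *
  omega

theorem eval_eq [Fintype N] {R : Type*} (T : OrdTree N) (F : N → List R → R) (t : N) :
    T.eval F t = F t ((T.children t).map (T.eval F)) := by
  rw [eval]
  congr 1
  exact List.map_subtype (fun _ _ => rfl) |>.trans (by rw [List.unattach_attach])

end OrdTree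

theorem mem_below [Fintype N] [DecidableEq N] (T : OrdTree N) (t s : N) : s ∈ below T t ↔ T.IsBelow t s := by
  rw [below, List.mem_toFinset, T.mem_postOrder]

-- When the traversal reaches a node, the entries of its children are already final, so the
-- sequential updates compute the recursive function. The initial state `o` is arbitrary because
-- each subtree is traversed in the state left by its earlier siblings.
open Classical in
theorem foldl_postOrder [Fintype N] [DecidableEq N] {R : Type*} (T : OrdTree N) (F : N → List R → R) (t : N) (o : N → R) :
    (T.postOrder t).foldl (fun o t => Function.update o t (F t ((T.children t).map o))) o =
      fun s => if T.IsBelow t s then T.eval F s else o s := by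
  have inner : ∀ (l : List N) (o : N → R), (∀ c ∈ l, ∀ o : N → R,
      (T.postOrder c).foldl (fun o t => Function.update o t (F t ((T.children t).map o))) o =
        fun s => if T.IsBelow c s then T.eval F s else o s) →
      (l.flatMap T.postOrder).foldl
        (fun o t => Function.update o t (F t ((T.children t).map o))) o =
        fun s => if ∃ c ∈ l, T.IsBelow c s then T.eval F s else o s := by
    intro l
    induction l with
    | nil => intro o _; simp
    | cons c l ih =>
      intro o h
      rw [List.flatMap_cons, List.foldl_append, h c (by simp),
        ih _ fun c' hc' => h c' (by simp [hc'])]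
      funext s
      by_cases h1 : T.IsBelow c s <;> simp [h1]
  induction t using T.induction generalizing o with
  | h t ih =>
    rw [T.postOrder_eq, List.foldl_append, inner _ _ fun c hc => ih c hc]
    have hmap : (T.children t).map
        (fun s => if ∃ c ∈ T.children t, T.IsBelow c s then T.eval F s else o s) =
        (T.children t).map (T.eval F) := by
      refine List.map_congr_left fun c hc => if_pos ⟨c, hc, Relation.ReflTransGen.refl⟩
    funext s
    rw [List.foldl_cons, List.foldl_nil, hmap, ← T.eval_eq F]
    by_cases hs : s = t
    · subst hs
      rw [Function.update_self, if_pos (OrdTree.IsBelow.refl T s)]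
    · rw [Function.update_of_ne hs]
      refine if_congr ?_ rfl rfl
      constructor
      · rintro ⟨c, hc, h⟩
        exact Relation.ReflTransGen.head hc h
      · intro h
        rcases Relation.ReflTransGen.cases_head h with h | ⟨c, hc, hs⟩
        · exact absurd h.symm hs
        · exact ⟨c, hc, hs⟩

theorem dynProg_eq [Fintype N] [DecidableEq N] {α R : Type*} [DecidableEq α]
    (A : N → Finset α → Program α → List (Finset R) → Finset R)
    (P : Program α) (T : OrdTree N) (χ : N → Finset α) (t : N) :
    dynProg A P T χ t =
      A t (χ t) (bagProgram P (χ t)) ((T.children t).map (dynProg A P T χ)) := by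
  have h : dynProg A P T χ = T.eval fun t L => A t (χ t) (bagProgram P (χ t)) L := by
    funext s
    have := foldl_postOrder T (fun t L => A t (χ t) (bagProgram P (χ t)) L) T.root fun _ => ∅
    exact (congrFun this s).trans (if_pos (T.isBelow_root s))
  rw [h, T.eval_eq]

/-! ### Connectedness of tree decompositions and cliques in bags. -/

section Decomposition

variable {α : Type*} [DecidableEq α] {V : Finset α} {G : SimpleGraph α} {T : OrdTree N}
  {χ : N → Finset α}

theorem IsTreeDecomposition.mem_bag_of_separated (h : IsTreeDecomposition V G T χ) {t x y : N}
    (hx : T.IsBelow t x) (hy : ¬ T.IsBelow t y) {v : α} (hvx : v ∈ χ x) (hvy : v ∈ χ y) :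
    v ∈ χ t := by
  obtain ⟨p, hp, -⟩ := T.isTree_graph.1.exists_path_of_dist x y
  exact h.path x t y p hp (OrdTree.mem_support_of_isBelow hx hy p)
    (Finset.mem_inter.2 ⟨hvx, hvy⟩)

/-- The bags containing a vertex have a topmost node. -/
theorem IsTreeDecomposition.exists_top [Fintype N] (h : IsTreeDecomposition V G T χ) {v : α} (hv : v ∈ V) :
    ∃ t, v ∈ χ t ∧ ∀ s, v ∈ χ s → T.IsBelow t s := by
  obtain ⟨t₀, ht₀⟩ := h.cover_vertex v hv
  obtain ⟨t, ht, hmin⟩ := Finset.exists_min_image (Finset.univ.filter fun t => v ∈ χ t) T.depth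
    ⟨t₀, by simpa using ht₀⟩
  simp only [Finset.mem_filter, Finset.mem_univ, true_and] at ht hmin
  refine ⟨t, ht, fun s hs => ?_⟩
  by_contra hn
  rcases Relation.ReflTransGen.cases_tail (T.isBelow_root t) with h1 | ⟨p, -, hp⟩
  · exact hn (h1 ▸ T.isBelow_root s)
  -- The path from `t` to `s` leaves the subtree of `t` through the parent of `t`. By connectedness
  -- the bag of this parent contains `v`, although its depth is smaller than the minimum.
  · obtain ⟨w, hw, -⟩ := T.isTree_graph.1.exists_path_of_dist t s
    obtain ⟨d, hd, h1, h2⟩ := w.exists_boundary_dart {s | T.IsBelow t s}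
      Relation.ReflTransGen.refl hn
    have h3 := OrdTree.eq_of_adj_isBelow h1 h2 d.adj
    have h4 : T.IsChild d.snd t := by
      rcases (T.adj_iff _ _).1 d.adj with h | h
      · exact absurd (Relation.ReflTransGen.tail h1 h) h2
      · rwa [h3] at h
    have h5 := h.path t d.snd s w hw (w.dart_snd_mem_support_of_mem_darts hd)
      (Finset.mem_inter.2 ⟨ht, hs⟩)
    have h6 := hmin _ h5
    rw [T.depth_child h4] at h6
    omega

/-- Every clique is contained in a bag. -/
theorem IsTreeDecomposition.exists_bag_of_clique [Fintype N] (h : IsTreeDecomposition V G T χ)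
    {A : Finset α} (hAV : A ⊆ V) (hA : ∀ u ∈ A, ∀ v ∈ A, u ≠ v → G.Adj u v) :
    ∃ t, A ⊆ χ t := by
  classical
  rcases A.eq_empty_or_nonempty with rfl | hne
  · exact ⟨T.root, by simp⟩
  have : Nonempty N := ⟨T.root⟩
  choose! top htop hbelow using fun v (hv : v ∈ A) => h.exists_top (hAV hv)
  -- The Helly property of subtrees: the deepest of the topmost nodes works for the whole clique.
  -- For another `u`, the node `top u` is `top v` itself or lies outside its subtree; in the latter
  -- case `top v` separates it from a bag shared by `u` and `v`.
  obtain ⟨v, hv, hmax⟩ := Finset.exists_max_image A (fun v => T.depth (top v)) hne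
  refine ⟨top v, fun u hu => ?_⟩
  rcases eq_or_ne u v with rfl | huv
  · exact htop u hu
  obtain ⟨s, hus, hvs⟩ := h.cover_edge u v (hA u hu v hv huv)
  by_cases hb : T.IsBelow (top v) (top u)
  · rcases Relation.ReflTransGen.cases_tail hb with h1 | ⟨p, hp, hpu⟩
    · exact h1 ▸ htop u hu
    · have h1 := OrdTree.IsBelow.depth_le hp
      have h2 := hmax u hu
      simp only [T.depth_child hpu] at h2
      omega
  · exact h.mem_bag_of_separated (hbelow v hv s hvs) hb hus (htop u hu)

end Decomposition

end Trees

/-! ### Answer sets of head-cycle-free programs as models with ordered proofs. -/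

section Programs

variable {α : Type*}

theorem exists_isChain_of_transGen {r : α → α → Prop} {a b : α} (h : Relation.TransGen r a b) :
    ∃ l : List α, List.IsChain r (a :: (l ++ [b])) := by
  induction h with
  | single h => exact ⟨[], by simpa using h⟩
  | @tail b c _ hbc ih =>
    obtain ⟨l, hl⟩ := ih
    refine ⟨l ++ [b], ?_⟩
    have : List.IsChain r ((a :: l) ++ b :: [c]) :=
      List.isChain_split.2 ⟨by simpa using hl, by simpa using hbc⟩
    simpa using this

/-- The two chains are concatenated. Since a cycle may repeat vertices, the closed walk needs no
shortening; this is the form that head-cycle-freeness excludes. -/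
theorem exists_cycle_of_transGen {r : α → α → Prop} {a b : α} (hab : Relation.TransGen r a b)
    (hba : Relation.TransGen r b a) : ∃ c : Cycle α, c.Chain r ∧ a ∈ c ∧ b ∈ c := by
  obtain ⟨l₁, h₁⟩ := exists_isChain_of_transGen hab
  obtain ⟨l₂, h₂⟩ := exists_isChain_of_transGen hba
  refine ⟨((a :: (l₁ ++ b :: l₂) : List α) : Cycle α), ?_, by simp, by simp⟩
  rw [Cycle.chain_coe_cons]
  have : List.IsChain r ((a :: l₁) ++ b :: (l₂ ++ [a])) :=
    List.isChain_split.2 ⟨by simpa using h₁, h₂⟩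
  simpa using this

/-- A finite nonempty set has an element that is minimal for a given transitive relation. -/
theorem exists_minimal_reach {r : α → α → Prop} {U : Finset α} (hU : U.Nonempty) :
    ∃ a ∈ U, ∀ x ∈ U, Relation.ReflTransGen r x a → Relation.ReflTransGen r a x := by
  classical
  -- The element with the fewest predecessors in `U` is taken: the predecessors of a predecessor `x`
  -- are among those of `a`, hence are the same ones, and include `a`.
  obtain ⟨a, ha, hmin⟩ := Finset.exists_min_image U
    (fun a => (U.filter fun x => Relation.ReflTransGen r x a).card) hU
  refine ⟨a, ha, fun x hx hxa => ?_⟩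
  have hsub : (U.filter fun y => Relation.ReflTransGen r y x) ⊆
      U.filter fun y => Relation.ReflTransGen r y a := by
    intro y hy
    rw [Finset.mem_filter] at hy ⊢
    exact ⟨hy.1, hy.2.trans hxa⟩
  have heq := Finset.eq_of_subset_of_card_le hsub (hmin x hx)
  have : a ∈ U.filter fun y => Relation.ReflTransGen r y a :=
    Finset.mem_filter.2 ⟨ha, Relation.ReflTransGen.refl⟩
  rw [← heq] at this
  exact (Finset.mem_filter.1 this).2

variable [DecidableEq α]

theorem Rule.sat_iff {I : Finset α} {r : Rule α} :
    r.Sat I ↔ (r.pos ⊆ I → r.neg ∩ I = ∅ → ∃ a ∈ r.head, a ∈ I) := by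
  unfold Rule.Sat
  rw [Finset.union_inter_distrib_right, Ne, Finset.union_eq_empty, Ne,
    Finset.sdiff_eq_empty_iff_subset]
  have : (∃ a ∈ r.head, a ∈ I) ↔ r.head ∩ I ≠ ∅ := by
    rw [← Finset.nonempty_iff_ne_empty]
    simp [Finset.Nonempty]
  rw [this]
  tauto

theorem Rule.head_subset_atoms (r : Rule α) : r.head ⊆ r.atoms := fun a h => by
  simp [Rule.atoms, h]

theorem Rule.pos_subset_atoms (r : Rule α) : r.pos ⊆ r.atoms := fun a h => by
  simp [Rule.atoms, h]

theorem Rule.neg_subset_atoms (r : Rule α) : r.neg ⊆ r.atoms := fun a h => by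
  simp [Rule.atoms, h]

theorem Rule.eq_empty_of_atoms {r : Rule α} (h : r.atoms = ∅) : r = Rule.empty := by
  have h1 := r.head_subset_atoms
  have h2 := r.pos_subset_atoms
  have h3 := r.neg_subset_atoms
  rw [h, Finset.subset_empty] at h1 h2 h3
  cases r
  simp_all [Rule.empty]

theorem Rule.not_sat_empty (I : Finset α) : ¬ (Rule.empty : Rule α).Sat I := by
  simp [Rule.Sat, Rule.empty]

theorem isModel_reduct_iff {P : Program α} {I J : Finset α} :
    IsModel J (P.reduct I) ↔
      ∀ r ∈ P, r.neg ∩ I = ∅ → r.pos ⊆ J → ∃ a ∈ r.head, a ∈ J := by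
  simp only [IsModel, Program.reduct, Finset.mem_image, Finset.mem_filter]
  constructor
  · intro h r hr hn hp
    exact (Rule.sat_iff (r := r.dropNeg)).1 (h r.dropNeg ⟨r, ⟨hr, hn⟩, rfl⟩) hp (Finset.empty_inter J)
  · rintro h _ ⟨r, ⟨hr, hn⟩, rfl⟩
    exact Rule.sat_iff.2 fun hp _ => h r hr hn hp

theorem isModel_reduct_self {P : Program α} {I : Finset α} :
    IsModel I (P.reduct I) ↔ IsModel I P := by
  rw [isModel_reduct_iff]
  simp only [IsModel, Rule.sat_iff]
  exact ⟨fun h r hr hp hn => h r hr hn hp, fun h r hr hn hp => h r hr hp hn⟩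

/-- Let `J ⊂ I` be a model of the reduct. Every prefix of `σ` lies in `J`: the rule proving the next
atom survives in the reduct and has its positive body in the prefix, so `J` contains one of its head
atoms, and the only one in `I` is the next atom. This direction holds for arbitrary programs. -/
theorem isAnswerSet_of_proven {P : Program α} {I : Finset α} {σ : List α} (hσ : IsOrdering σ I)
    (hI : IsModel I P) (hp : ∀ a ∈ I, Proven P I σ a) : IsAnswerSet P I := by
  refine ⟨isModel_reduct_self.2 hI, fun J hJ hm => ?_⟩
  rw [isModel_reduct_iff] at hm
  have key : ∀ l₁ l₂ : List α, l₁ ++ l₂ = σ → ∀ a ∈ l₁, a ∈ J := by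
    intro l₁
    induction l₁ using List.reverseRecOn with
    | nil => simp
    | append_singleton l₁ x ih =>
      intro l₂ hl a ha
      have ih' := ih (x :: l₂) (by simpa using hl)
      rcases List.mem_append.1 ha with ha | ha
      · exact ih' a ha
      obtain rfl := List.mem_singleton.1 ha
      have haI : a ∈ I := by
        rw [← hσ.2, ← hl]; simp
      obtain ⟨-, r, hr, har, hpos, hbef, hneg, hhead⟩ := hp a haI
      obtain ⟨b, hb, hbJ⟩ := hm r hr (by rwa [Finset.inter_comm]) (by
        intro b hb
        refine ih' b ?_
        have h1 := hbef b hb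
        have hnd := hσ.1
        rw [← hl] at h1 hnd
        rw [Before, List.append_assoc, List.singleton_append] at h1
        rw [List.append_assoc, List.singleton_append] at hnd
        -- As `a` occurs only once in `σ`, everything before `a` lies in the prefix `l₁`.
        obtain ⟨s₁, s₂, hs, hs₁, hs₂⟩ := List.sublist_append_iff.1 h1
        have hal : a ∉ l₁ := by
          intro h
          exact (List.disjoint_of_nodup_append hnd) h (by simp)
        have hal₂ : a ∉ l₂ := by
          have := (List.nodup_append.1 hnd).2.1
          exact (List.nodup_cons.1 this).1
        rcases s₁ with _ | ⟨c, s₁⟩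
        · simp only [List.nil_append] at hs
          subst hs
          rcases List.sublist_cons_iff.1 hs₂ with h | ⟨_, h, h'⟩
          · exact absurd (h.subset (by simp)) hal₂
          · simp only [List.cons.injEq] at h
            obtain ⟨-, rfl⟩ := h
            exact absurd (h'.subset (by simp)) hal₂
        · simp only [List.cons_append, List.cons.injEq] at hs
          exact hs.1 ▸ hs₁.subset (by simp))
      have : b = a := by
        by_contra hne
        have : b ∈ I ∩ (r.head \ {a}) := by simp [hJ.1 hbJ, hb, hne]
        simp [hhead] at this
      exact this ▸ hbJ
  refine hJ.2 fun a ha => ?_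
  rw [← hσ.2, List.mem_toFinset] at ha
  exact key σ [] (by simp) a ha

/-- In an answer set of a head-cycle-free program, every proper subset can be extended by an atom
that is supported by the subset. -/
theorem IsAnswerSet.exists_supported {P : Program α} (hP : HeadCycleFree P) {I S : Finset α}
    (hI : IsAnswerSet P I) (hS : S ⊂ I) :
    ∃ a ∈ I, a ∉ S ∧ ∃ r ∈ P, a ∈ r.head ∧ r.pos ⊆ S ∧ I ∩ r.neg = ∅ ∧
      I ∩ (r.head \ {a}) = ∅ := by
  classical
  -- Every atom of `I \ S` that reaches `m` is also reached by `m`, so the set `C` of these atoms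
  -- lies in one strongly connected component.
  obtain ⟨m, hm, hmin⟩ := exists_minimal_reach (r := DepArc P)
    (Finset.sdiff_nonempty.2 hS.2 : (I \ S).Nonempty)
  rw [Finset.mem_sdiff] at hm
  set C := (I \ S).filter fun x => Relation.ReflTransGen (DepArc P) x m with hC
  have hCm : ∀ x, x ∈ C ↔ x ∈ I ∧ x ∉ S ∧ Relation.ReflTransGen (DepArc P) x m := by
    intro x
    rw [hC, Finset.mem_filter, Finset.mem_sdiff, and_assoc]
  -- By minimality `I \ C` violates a rule of the reduct. As `I` satisfies that rule, its head meets
  -- `I`, and only inside `C`.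
  have hnot := hI.2 (I \ C) (Finset.ssubset_iff_subset_ne.2 ⟨Finset.sdiff_subset, fun h => by
    have : m ∈ I \ C := h.symm ▸ hm.1
    exact (Finset.mem_sdiff.1 this).2 ((hCm m).2 ⟨hm.1, hm.2, .refl⟩)⟩)
  rw [isModel_reduct_iff] at hnot
  push Not at hnot
  obtain ⟨r, hr, hneg, hpos, hhead⟩ := hnot
  obtain ⟨a, har, haI⟩ := isModel_reduct_iff.1 hI.1 r hr hneg (hpos.trans Finset.sdiff_subset)
  have hheadC : ∀ b ∈ r.head, b ∈ I → b ∈ C := fun b hb hbI => by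
    by_contra hbC
    exact hhead b hb (Finset.mem_sdiff.2 ⟨hbI, hbC⟩)
  have haC := (hCm a).1 (hheadC a har haI)
  refine ⟨a, haI, haC.2.1, r, hr, har, ?_, by rwa [Finset.inter_comm], ?_⟩
  -- A body atom outside `S` would reach `m` through `a` and so belong to `C`, which the positive
  -- body avoids.
  · intro b hb
    have hb' := Finset.mem_sdiff.1 (hpos hb)
    by_contra hbS
    exact hb'.2 ((hCm b).2 ⟨hb'.1, hbS, .head ⟨r, hr, hb, har⟩ haC.2.2⟩)
  · rw [Finset.eq_empty_iff_forall_notMem]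
    intro b hb
    simp only [Finset.mem_inter, Finset.mem_sdiff, Finset.mem_singleton] at hb
    obtain ⟨hbI, hbr, hba⟩ := hb
    have hbC := (hCm b).1 (hheadC b hbr hbI)
    -- A second true head atom would be mutually reachable with `a` through `m`, giving a forbidden
    -- cycle.
    have ham := hmin a (Finset.mem_sdiff.2 ⟨haC.1, haC.2.1⟩) haC.2.2
    have hbm := hmin b (Finset.mem_sdiff.2 ⟨hbC.1, hbC.2.1⟩) hbC.2.2
    have hab := (Relation.reflTransGen_iff_eq_or_transGen.1 (haC.2.2.trans hbm)).resolve_left hba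
    have hba' := (Relation.reflTransGen_iff_eq_or_transGen.1
      (hbC.2.2.trans ham)).resolve_left (Ne.symm hba)
    exact hP ⟨r, hr, a, har, b, hbr, Ne.symm hba, exists_cycle_of_transGen hab hba'⟩

/-- The ordering grows by repeatedly appending an atom supported by the atoms listed so far;
appending does not disturb the proofs of earlier atoms. -/
theorem IsAnswerSet.exists_ordering {P : Program α} (hP : HeadCycleFree P) {I : Finset α}
    (hI : IsAnswerSet P I) : ∃ σ, IsOrdering σ I ∧ ∀ a ∈ I, Proven P I σ a := by
  have key : ∀ n ≤ I.card, ∃ σ : List α, σ.Nodup ∧ σ.length = n ∧ σ.toFinset ⊆ I ∧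
      ∀ a ∈ σ, Proven P I σ a := by
    intro n
    induction n with
    | zero => exact fun _ => ⟨[], by simp⟩
    | succ n ih =>
      intro hn
      obtain ⟨σ, hnd, hlen, hsub, hprov⟩ := ih (by omega)
      have hss : σ.toFinset ⊂ I := by
        refine Finset.ssubset_iff_subset_ne.2 ⟨hsub, fun h => ?_⟩
        have := List.toFinset_card_of_nodup hnd
        rw [h] at this
        omega
      obtain ⟨a, haI, haσ, r, hr, har, hpos, hneg, hhead⟩ := hI.exists_supported hP hss
      rw [List.mem_toFinset] at haσ
      refine ⟨σ ++ [a], ?_, by simp [hlen], ?_, ?_⟩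
      · rw [← List.concat_eq_append]
        exact hnd.concat haσ
      · intro b hb
        simp only [List.toFinset_append, Finset.mem_union, List.mem_toFinset,
          List.mem_singleton] at hb
        rcases hb with hb | rfl
        · exact hsub (List.mem_toFinset.2 hb)
        · exact haI
      · intro b hb
        rcases List.mem_append.1 hb with hb | hb
        · obtain ⟨h1, r, h2, h3, h4, h5, h6⟩ := hprov b hb
          exact ⟨h1, r, h2, h3, h4,
            fun c hc => (h5 c hc).trans (List.sublist_append_left _ _), h6⟩
        · obtain rfl := List.mem_singleton.1 hb
          refine ⟨haI, r, hr, har, hpos.trans hsub, fun c hc => ?_, hneg, hhead⟩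
          have : [c].Sublist σ := List.singleton_sublist.2 (List.mem_toFinset.1 (hpos hc))
          exact this.append (List.Sublist.refl [b])
  obtain ⟨σ, hnd, hlen, hsub, hprov⟩ := key _ le_rfl
  have heq : σ.toFinset = I := Finset.eq_of_subset_of_card_le hsub
    (by rw [List.toFinset_card_of_nodup hnd, hlen])
  refine ⟨σ, ⟨hnd, heq⟩, fun a ha => hprov a ?_⟩
  rwa [← heq, List.mem_toFinset] at ha

theorem IsAnswerSet.subset_atoms {P : Program α} (hP : HeadCycleFree P) {I : Finset α}
    (hI : IsAnswerSet P I) : I ⊆ P.atoms := by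
  obtain ⟨σ, -, h⟩ := hI.exists_ordering hP
  intro a ha
  obtain ⟨-, r, hr, har, -⟩ := h a ha
  exact Finset.mem_biUnion.2 ⟨r, hr, r.head_subset_atoms har⟩

/-! Locality. -/

theorem IsOrdering.mem_iff {σ : List α} {I : Finset α} (h : IsOrdering σ I) {a : α} :
    a ∈ σ ↔ a ∈ I := by
  rw [← h.2, List.mem_toFinset]

theorem isOrdering_iff {σ : List α} {I : Finset α} :
    IsOrdering σ I ↔ σ.Nodup ∧ ∀ a, a ∈ σ ↔ a ∈ I := by
  refine ⟨fun h => ⟨h.1, fun a => h.mem_iff⟩, fun h => ⟨h.1, ?_⟩⟩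
  ext a
  rw [List.mem_toFinset, h.2]

theorem IsOrdering.filter {σ : List α} {I : Finset α} (h : IsOrdering σ I) (A : Finset α) :
    IsOrdering (σ.filter (· ∈ A)) (I ∩ A) := by
  rw [isOrdering_iff] at h ⊢
  exact ⟨h.1.filter _, fun a => by simp [h.2]⟩

theorem before_filter {σ : List α} {A : Finset α} {a b : α} (ha : a ∈ A) (hb : b ∈ A) :
    Before (σ.filter (· ∈ A)) b a ↔ Before σ b a := by
  refine ⟨fun h => List.Sublist.trans h List.filter_sublist, fun h => ?_⟩
  have := List.Sublist.filter (· ∈ A) h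
  simpa [Before, ha, hb] using this

theorem Rule.sat_inter {I A : Finset α} {r : Rule α} (h : r.atoms ⊆ A) :
    r.Sat (I ∩ A) ↔ r.Sat I := by
  have h1 := r.head_subset_atoms.trans h
  have h2 := r.pos_subset_atoms.trans h
  have h3 := r.neg_subset_atoms.trans h
  rw [Rule.sat_iff, Rule.sat_iff, Finset.subset_inter_iff, and_iff_left h2, Finset.inter_comm I,
    ← Finset.inter_assoc, Finset.inter_eq_left.2 h3]
  refine imp_congr_right fun _ => imp_congr_right fun _ => exists_congr fun a => ?_
  rw [Finset.mem_inter]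
  exact ⟨fun h => ⟨h.1, h.2.2⟩, fun h => ⟨h.1, h1 h.1, h.2⟩⟩

/-- The atoms of all rules of `P` belong to `A`. -/
def ProgramIn (P : Program α) (A : Finset α) : Prop := ∀ r ∈ P, r.atoms ⊆ A

theorem isModel_inter {P : Program α} {I A : Finset α} (h : ProgramIn P A) :
    IsModel (I ∩ A) P ↔ IsModel I P :=
  forall₂_congr fun r hr => Rule.sat_inter (h r hr)

theorem isModel_union {P₁ P₂ : Program α} {I : Finset α} :
    IsModel I (P₁ ∪ P₂) ↔ IsModel I P₁ ∧ IsModel I P₂ := by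
  simp only [IsModel, Finset.mem_union, or_imp, forall_and]

theorem Proven.mem {P : Program α} {I : Finset α} {σ : List α} {a : α} (h : Proven P I σ a) :
    a ∈ I := h.1

theorem Proven.mem_of_programIn {P : Program α} {I A : Finset α} {σ : List α} {a : α}
    (h : Proven P I σ a) (hP : ProgramIn P A) : a ∈ A := by
  obtain ⟨-, r, hr, har, -⟩ := h
  exact hP r hr (r.head_subset_atoms har)

theorem proven_union {P₁ P₂ : Program α} {I : Finset α} {σ : List α} {a : α} :
    Proven (P₁ ∪ P₂) I σ a ↔ Proven P₁ I σ a ∨ Proven P₂ I σ a := by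
  unfold Proven
  constructor
  · rintro ⟨h, r, hr, h'⟩
    rcases Finset.mem_union.1 hr with hr | hr
    · exact Or.inl ⟨h, r, hr, h'⟩
    · exact Or.inr ⟨h, r, hr, h'⟩
  · rintro (⟨h, r, hr, h'⟩ | ⟨h, r, hr, h'⟩)
    · exact ⟨h, r, Finset.mem_union_left _ hr, h'⟩
    · exact ⟨h, r, Finset.mem_union_right _ hr, h'⟩

theorem proven_inter {P : Program α} {I A : Finset α} {σ : List α} {a : α} (h : ProgramIn P A) :
    Proven P (I ∩ A) (σ.filter (· ∈ A)) a ↔ Proven P I σ a := by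
  have key : ∀ X ⊆ A, I ∩ A ∩ X = I ∩ X := fun X hX => by
    rw [Finset.inter_assoc, Finset.inter_eq_right.2 hX]
  unfold Proven
  constructor
  · rintro ⟨ha, r, hr, har, hpos, hbef, hneg, hhead⟩
    have h1 := r.head_subset_atoms.trans (h r hr)
    have h2 := r.pos_subset_atoms.trans (h r hr)
    have h3 := r.neg_subset_atoms.trans (h r hr)
    rw [key _ h3] at hneg
    rw [key _ (Finset.sdiff_subset.trans h1)] at hhead
    exact ⟨(Finset.mem_inter.1 ha).1, r, hr, har, hpos.trans Finset.inter_subset_left,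
      fun b hb => (before_filter (h1 har) (h2 hb)).1 (hbef b hb), hneg, hhead⟩
  · rintro ⟨ha, r, hr, har, hpos, hbef, hneg, hhead⟩
    have h1 := r.head_subset_atoms.trans (h r hr)
    have h2 := r.pos_subset_atoms.trans (h r hr)
    have h3 := r.neg_subset_atoms.trans (h r hr)
    rw [← key _ h3] at hneg
    rw [← key _ (Finset.sdiff_subset.trans h1)] at hhead
    exact ⟨Finset.mem_inter.2 ⟨ha, h1 har⟩, r, hr, har, Finset.subset_inter hpos h2,
      fun b hb => (before_filter (h1 har) (h2 hb)).2 (hbef b hb), hneg, hhead⟩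

/-- For models, the set of atoms proven by the rules consists of the proven atoms of the model. -/
theorem mem_gatherProof {P : Program α} {I : Finset α} {σ : List α} (hI : IsModel I P) {a : α} :
    a ∈ gatherProof I σ P ↔ Proven P I σ a := by
  simp only [gatherProof, Finset.mem_biUnion, Finset.mem_filter]
  constructor
  · rintro ⟨r, hr, har, hpos, hneg, hhead, hbef⟩
    refine ⟨?_, r, hr, har, hpos, hbef, hneg, hhead⟩
    obtain ⟨b, hb, hbI⟩ := Rule.sat_iff.1 (hI r hr) hpos (by rwa [Finset.inter_comm])
    by_contra ha
    have : b ∈ I ∩ (r.head \ {a}) := by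
      simp only [Finset.mem_inter, Finset.mem_sdiff, Finset.mem_singleton]
      exact ⟨hbI, hb, fun h => ha (h ▸ hbI)⟩
    simp [hhead] at this
  · rintro ⟨-, r, hr, har, hpos, hbef, hneg, hhead⟩
    exact ⟨r, hr, har, hpos, hneg, hhead, hbef⟩

/-! Gluing of partial solutions. -/

/-- `(I, σ)` is a model of `P` over the atoms `A` with an ordering that proves all atoms
outside `B`. -/
structure IsSolution (P : Program α) (A B I : Finset α) (σ : List α) : Prop where
  subset : I ⊆ A
  ordering : IsOrdering σ I
  model : IsModel I P
  proven : ∀ a ∈ I, a ∉ B → Proven P I σ a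

/-- The row `u` is the restriction of `(I, σ)` and its set of proven atoms to `B`. -/
structure IsTrace (P : Program α) (B I : Finset α) (σ : List α) (u : Row α) : Prop where
  interp : u.1 = I ∩ B
  proven : ∀ a, a ∈ u.2.1 ↔ a ∈ B ∧ Proven P I σ a
  seq : u.2.2 = σ.filter (· ∈ B)

theorem exists_isTrace (P : Program α) (B I : Finset α) (σ : List α) :
    ∃ u, IsTrace P B I σ u := by
  classical
  exact ⟨(I ∩ B, B.filter (Proven P I σ), σ.filter (· ∈ B)), rfl, fun a => by simp, rfl⟩

/-- An atom of `A₁` outside `B₁` does not occur in `A₂`, so no rule of `P₂` can prove it, and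
symmetrically. Allowing different bags for the two parts covers introduce nodes, where the second
part is the bag itself (`A₂ = B₂ = B`), as well as join nodes, where all bags coincide. -/
theorem isSolution_union {P₁ P₂ : Program α} {A₁ A₂ B₁ B₂ B I : Finset α} {σ : List α}
    (h₁ : ProgramIn P₁ A₁) (h₂ : ProgramIn P₂ A₂) (hI : I ⊆ A₁ ∪ A₂) (hσ : IsOrdering σ I)
    (hA₁ : A₁ ∩ A₂ ⊆ B₁) (hA₂ : A₁ ∩ A₂ ⊆ B₂) (hB₁ : B₁ ⊆ B) (hB₂ : B₂ ⊆ B)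
    (hBA₁ : B ∩ A₁ ⊆ B₁) (hBA₂ : B ∩ A₂ ⊆ B₂) :
    IsSolution (P₁ ∪ P₂) (A₁ ∪ A₂) B I σ ↔
      IsSolution P₁ A₁ B₁ (I ∩ A₁) (σ.filter (· ∈ A₁)) ∧
      IsSolution P₂ A₂ B₂ (I ∩ A₂) (σ.filter (· ∈ A₂)) := by
  constructor
  · intro h
    have hm := isModel_union.1 h.model
    refine ⟨⟨Finset.inter_subset_right, hσ.filter _, (isModel_inter h₁).2 hm.1, ?_⟩,
      ⟨Finset.inter_subset_right, hσ.filter _, (isModel_inter h₂).2 hm.2, ?_⟩⟩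
    · intro a ha haB
      rw [Finset.mem_inter] at ha
      rw [proven_inter h₁]
      have haB' : a ∉ B := fun h => haB (hBA₁ (Finset.mem_inter.2 ⟨h, ha.2⟩))
      refine (proven_union.1 (h.proven a ha.1 haB')).resolve_right fun hp => haB (hA₁ ?_)
      exact Finset.mem_inter.2 ⟨ha.2, hp.mem_of_programIn h₂⟩
    · intro a ha haB
      rw [Finset.mem_inter] at ha
      rw [proven_inter h₂]
      have haB' : a ∉ B := fun h => haB (hBA₂ (Finset.mem_inter.2 ⟨h, ha.2⟩))
      refine (proven_union.1 (h.proven a ha.1 haB')).resolve_left fun hp => haB (hA₂ ?_)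
      exact Finset.mem_inter.2 ⟨hp.mem_of_programIn h₁, ha.2⟩
  · rintro ⟨h, h'⟩
    refine ⟨hI, hσ, isModel_union.2 ⟨(isModel_inter h₁).1 h.model,
      (isModel_inter h₂).1 h'.model⟩, fun a ha haB => proven_union.2 ?_⟩
    rcases Finset.mem_union.1 (hI ha) with haA | haA
    · exact Or.inl ((proven_inter h₁).1 (h.proven a (Finset.mem_inter.2 ⟨ha, haA⟩)
        fun h => haB (hB₁ h)))
    · exact Or.inr ((proven_inter h₂).1 (h'.proven a (Finset.mem_inter.2 ⟨ha, haA⟩)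
        fun h => haB (hB₂ h)))

/-- Two sequences that agree on the common atoms have a common extension. -/
theorem exists_merge (A₁ A₂ : Finset α) : ∀ (n : ℕ) (σ₁ σ₂ : List α),
    σ₁.length + σ₂.length = n → σ₁.Nodup → σ₂.Nodup → (∀ a ∈ σ₁, a ∈ A₁) → (∀ a ∈ σ₂, a ∈ A₂) →
    σ₁.filter (· ∈ A₂) = σ₂.filter (· ∈ A₁) →
    ∃ σ : List α, σ.Nodup ∧ (∀ a, a ∈ σ ↔ a ∈ σ₁ ∨ a ∈ σ₂) ∧
      σ.filter (· ∈ A₁) = σ₁ ∧ σ.filter (· ∈ A₂) = σ₂ := by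
  intro n
  induction n using Nat.strong_induction_on with
  | _ n ih =>
    intro σ₁ σ₂ hn hd₁ hd₂ hm₁ hm₂ heq
    rcases σ₁ with _ | ⟨x, l₁⟩
    · refine ⟨σ₂, hd₂, by simp, by simpa using heq.symm, ?_⟩
      exact List.filter_eq_self.2 (by simpa using hm₂)
    rw [List.nodup_cons] at hd₁
    have hm₁' : ∀ a ∈ l₁, a ∈ A₁ := fun a ha => hm₁ a (by simp [ha])
    have hx₁ : x ∈ A₁ := hm₁ x (by simp)
    -- The merge emits a first element that is private to its side, or the common first element when
    -- both are shared; in that case agreement on the shared atoms makes the two equal.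
    by_cases hx : x ∈ A₂
    · rcases σ₂ with _ | ⟨y, l₂⟩
      · simp [hx] at heq
      rw [List.nodup_cons] at hd₂
      have hm₂' : ∀ a ∈ l₂, a ∈ A₂ := fun a ha => hm₂ a (by simp [ha])
      have hy₂ : y ∈ A₂ := hm₂ y (by simp)
      by_cases hy : y ∈ A₁
      · simp only [List.filter_cons, hx, hy, decide_true, if_true, List.cons.injEq] at heq
        obtain ⟨rfl, heq⟩ := heq
        obtain ⟨σ, h1, h2, h3, h4⟩ := ih _ (by simp at hn; omega) l₁ l₂ rfl hd₁.2 hd₂.2 hm₁' hm₂'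
          heq
        refine ⟨x :: σ, List.nodup_cons.2 ⟨?_, h1⟩, ?_, ?_, ?_⟩
        · rw [h2]; exact not_or.2 ⟨hd₁.1, hd₂.1⟩
        · intro a; simp only [List.mem_cons, h2]; tauto
        · simp [hx₁, h3]
        · simp [hx, h4]
      · rw [List.filter_cons_of_neg (a := y) (by simpa using hy)] at heq
        obtain ⟨σ, h1, h2, h3, h4⟩ := ih _ (by simp at hn ⊢; omega) (x :: l₁) l₂ rfl
          (List.nodup_cons.2 hd₁) hd₂.2 hm₁ hm₂' heq
        refine ⟨y :: σ, List.nodup_cons.2 ⟨?_, h1⟩, ?_, ?_, ?_⟩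
        · rw [h2]; exact not_or.2 ⟨fun h => hy (hm₁ _ h), hd₂.1⟩
        · intro a; simp only [List.mem_cons, h2]; tauto
        · simp [hy, h3]
        · simp [hy₂, h4]
    · rw [List.filter_cons_of_neg (by simpa using hx)] at heq
      obtain ⟨σ, h1, h2, h3, h4⟩ := ih _ (by simp at hn; omega) l₁ σ₂ rfl hd₁.2 hd₂ hm₁' hm₂ heq
      refine ⟨x :: σ, List.nodup_cons.2 ⟨?_, h1⟩, ?_, ?_, ?_⟩
      · rw [h2]; exact not_or.2 ⟨hd₁.1, fun h => hx (hm₂ _ h)⟩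
      · intro a; simp only [List.mem_cons, h2]; tauto
      · simp [hx₁, h3]
      · simp [hx, h4]

end Programs

/-! ### Rows, and the row operations described by restriction to bags. -/

section Rows

variable {α : Type*}

theorem insertIdx_length_append (s l : List α) (a : α) :
    (s ++ l).insertIdx s.length a = s ++ a :: l := by
  induction s with
  | nil => simp
  | cons x s ih => simp [ih]

variable [DecidableEq α]

theorem mem_possOrd_empty {σ σ' : List α} : σ' ∈ possOrd σ ∅ ↔ σ' = σ := by
  simp [possOrd]

theorem mem_possOrd_singleton {σ σ' : List α} {a : α} :
    σ' ∈ possOrd σ {a} ↔ ∃ s l, σ = s ++ l ∧ σ' = s ++ a :: l := by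
  simp only [possOrd, Finset.singleton_ne_empty, if_false, Finset.empty_union,
    Finset.singleton_biUnion, Finset.mem_image, Finset.mem_range]
  constructor
  · rintro ⟨i, hi, rfl⟩
    refine ⟨σ.take i, σ.drop i, by simp, ?_⟩
    conv_lhs => rw [← List.take_append_drop i σ]
    have : i = (σ.take i).length := by simp; omega
    conv_lhs => arg 2; rw [this]
    exact insertIdx_length_append _ _ _
  · rintro ⟨s, l, rfl, rfl⟩
    exact ⟨s.length, by simp, insertIdx_length_append s l a⟩

/-- The row consists of an interpretation over the bag, a subset, and an ordering. -/
def GoodRow (B : Finset α) (u : Row α) : Prop :=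
  u.1 ⊆ B ∧ u.2.1 ⊆ u.1 ∧ IsOrdering u.2.2 u.1

theorem IsTrace.goodRow {P : Program α} {B I : Finset α} {σ : List α} {u : Row α}
    (h : IsTrace P B I σ u) (hσ : IsOrdering σ I) : GoodRow B u := by
  refine ⟨h.interp ▸ Finset.inter_subset_right, fun a ha => ?_, ?_⟩
  · rw [h.proven] at ha
    rw [h.interp, Finset.mem_inter]
    exact ⟨ha.2.mem, ha.1⟩
  · rw [h.interp, h.seq]
    exact hσ.filter B

theorem IsTrace.unique {P : Program α} {B I : Finset α} {σ : List α} {u v : Row α}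
    (hu : IsTrace P B I σ u) (hv : IsTrace P B I σ v) : u = v := by
  obtain ⟨u1, u2, u3⟩ := u
  obtain ⟨v1, v2, v3⟩ := v
  have h1 : u1 = v1 := hu.interp.trans hv.interp.symm
  have h2 : u2 = v2 := by
    ext a
    exact (hu.proven a).trans (hv.proven a).symm
  have h3 : u3 = v3 := hu.seq.trans hv.seq.symm
  rw [h1, h2, h3]

/-- The row `u` arises from `s` by extending the bag from `B'` to `B`. -/
structure IntroRel (P : Program α) (B' B : Finset α) (s u : Row α) : Prop where
  subset : u.1 ⊆ B
  interp : u.1 ∩ B' = s.1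
  ordering : IsOrdering u.2.2 u.1
  seq : u.2.2.filter (· ∈ B') = s.2.2
  model : IsModel u.1 P
  proven : ∀ b, b ∈ u.2.1 ↔ b ∈ s.2.1 ∨ Proven P u.1 u.2.2 b

/-- The row `u` arises from `s` by removing `a`. -/
def RemoveRel (a : α) (s u : Row α) : Prop :=
  (a ∈ s.2.1 ∨ a ∉ s.1) ∧ u = (s.1.erase a, s.2.1.erase a, s.2.2.erase a)

/-- The row `u` arises from `s₁` and `s₂` at a join node. -/
def JoinRel (s₁ s₂ u : Row α) : Prop :=
  s₂.1 = s₁.1 ∧ s₂.2.2 = s₁.2.2 ∧ u = (s₁.1, s₁.2.1 ∪ s₂.2.1, s₁.2.2)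

/-- Inserting `a` at some position is the same as choosing an ordering that gives back the old
sequence when restricted to `B'`. The restriction form is the one that gluing uses. -/
theorem introRel_iff {P : Program α} {B' : Finset α} {a : α} (ha : a ∉ B') {s u : Row α}
    (hs : GoodRow B' s) :
    IntroRel P B' (insert a B') s u ↔
      (u.1 = s.1 ∨ u.1 = insert a s.1) ∧ IsModel u.1 P ∧ u.2.2 ∈ possOrd s.2.2 ({a} ∩ u.1) ∧
        u.2.1 = s.2.1 ∪ gatherProof u.1 u.2.2 P := by
  obtain ⟨I, Q, σ⟩ := s
  obtain ⟨J, R, ρ⟩ := u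
  obtain ⟨hI, -, hσ⟩ := hs
  dsimp only at hI hσ ⊢
  have haI : a ∉ I := fun h => ha (hI h)
  constructor
  · rintro ⟨h1, h2, h3, h4, h5, h6⟩
    dsimp only at *
    have hR : R = Q ∪ gatherProof J ρ P := by
      ext b
      rw [h6, Finset.mem_union, mem_gatherProof h5]
    by_cases haJ : a ∈ J
    · refine ⟨Or.inr ?_, h5, ?_, hR⟩
      · ext b
        rw [Finset.mem_insert, ← h2, Finset.mem_inter]
        constructor
        · intro hb
          exact (Finset.mem_insert.1 (h1 hb)).imp_right fun h => ⟨hb, h⟩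
        · rintro (rfl | h)
          exacts [haJ, h.1]
      · rw [Finset.inter_eq_left.2 (by simpa using haJ), mem_possOrd_singleton]
        obtain ⟨s, l, hsl⟩ := List.append_of_mem (h3.mem_iff.2 haJ)
        refine ⟨s, l, ?_, hsl⟩
        have hnd := h3.1
        rw [hsl, List.nodup_middle, List.nodup_cons] at hnd
        have hmem : ∀ b ∈ s ++ l, b ∈ B' := by
          intro b hb
          have hbρ : b ∈ ρ := by
            rw [hsl]; simp only [List.mem_append, List.mem_cons] at hb ⊢; tauto
          refine (Finset.mem_insert.1 (h1 (h3.mem_iff.1 hbρ))).resolve_left ?_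
          rintro rfl
          exact hnd.1 hb
        rw [← h4, hsl, List.filter_append, List.filter_cons_of_neg (by simpa using ha),
          ← List.filter_append]
        exact (List.filter_eq_self.2 (by simpa using hmem))
    · have hJB : J ⊆ B' := fun b hb => (Finset.mem_insert.1 (h1 hb)).resolve_left
        fun h => haJ (h ▸ hb)
      refine ⟨Or.inl ?_, h5, ?_, hR⟩
      · rw [← h2, Finset.inter_eq_left.2 hJB]
      · rw [Finset.singleton_inter_of_notMem haJ, mem_possOrd_empty, ← h4]
        exact (List.filter_eq_self.2 (by
          intro b hb
          simpa using hJB (h3.mem_iff.1 hb))).symm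
  · rintro ⟨h1, h2, h3, h4⟩
    have hR : ∀ b, b ∈ R ↔ b ∈ Q ∨ Proven P J ρ b := fun b => by
      rw [h4, Finset.mem_union, mem_gatherProof h2]
    have hmem : ∀ b ∈ σ, b ∈ B' := fun b hb => hI (hσ.mem_iff.1 hb)
    rcases h1 with rfl | rfl
    · rw [Finset.singleton_inter_of_notMem haI, mem_possOrd_empty] at h3
      subst h3
      exact ⟨hI.trans (Finset.subset_insert _ _), Finset.inter_eq_left.2 hI, hσ,
        List.filter_eq_self.2 (by simpa using hmem), h2, hR⟩
    · rw [Finset.inter_eq_left.2 (by simp), mem_possOrd_singleton] at h3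
      obtain ⟨s, l, rfl, rfl⟩ := h3
      refine ⟨Finset.insert_subset_insert _ hI, ?_, ?_, ?_, h2, hR⟩
      · rw [Finset.insert_inter_of_notMem ha, Finset.inter_eq_left.2 hI]
      · rw [isOrdering_iff] at hσ ⊢
        refine ⟨?_, fun b => ?_⟩
        · rw [List.nodup_middle, List.nodup_cons, hσ.2]
          exact ⟨haI, hσ.1⟩
        · rw [Finset.mem_insert, ← hσ.2]
          simp only [List.mem_append, List.mem_cons]
          tauto
      · dsimp only
        rw [List.filter_append, List.filter_cons_of_neg (by simpa using ha),
          ← List.filter_append]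
        exact (List.filter_eq_self.2 (by simpa using hmem))

theorem IntroRel.goodRow {P : Program α} {B' B : Finset α} {s u : Row α}
    (h : IntroRel P B' B s u) (hs : GoodRow B' s) : GoodRow B u := by
  refine ⟨h.subset, fun b hb => ?_, h.ordering⟩
  rcases (h.proven b).1 hb with hb | hb
  · have := hs.2.1 hb
    rw [← h.interp] at this
    exact (Finset.mem_inter.1 this).1
  · exact hb.mem

theorem RemoveRel.goodRow {B : Finset α} {a : α} {s u : Row α} (h : RemoveRel a s u)
    (hs : GoodRow (insert a B) s) : GoodRow B u := by
  obtain ⟨-, rfl⟩ := h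
  refine ⟨?_, Finset.erase_subset_erase _ hs.2.1, ?_⟩
  · exact Finset.subset_insert_iff.1 hs.1
  · have h := isOrdering_iff.1 hs.2.2
    rw [isOrdering_iff]
    refine ⟨h.1.erase _, fun b => ?_⟩
    rw [h.1.mem_erase_iff, Finset.mem_erase, h.2]

theorem JoinRel.goodRow {B : Finset α} {s₁ s₂ u : Row α} (h : JoinRel s₁ s₂ u)
    (h₁ : GoodRow B s₁) (h₂ : GoodRow B s₂) : GoodRow B u := by
  obtain ⟨h, -, rfl⟩ := h
  exact ⟨h₁.1, Finset.union_subset h₁.2.1 (h ▸ h₂.2.1), h₁.2.2⟩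

end Rows

/-! ### Tables and extensions as recursions over the four node types. -/

section Tables

variable {α N : Type*} [DecidableEq α]

/-- The cardinality conditions on bags are traded for a named atom `a`. -/
theorem IsNice.cases {T : OrdTree N} {χ : N → Finset α} (h : IsNice T χ) (t : N) :
    (T.children t = [] ∧ nodeType T χ t = some .leaf ∧ χ t = ∅) ∨
    (∃ t' a, T.children t = [t'] ∧ nodeType T χ t = some (.int t') ∧ a ∉ χ t' ∧
      χ t = insert a (χ t')) ∨
    (∃ t' a, T.children t = [t'] ∧ nodeType T χ t = some (.rem t') ∧ a ∉ χ t ∧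
      χ t' = insert a (χ t)) ∨
    (∃ t₁ t₂, T.children t = [t₁, t₂] ∧ nodeType T χ t = some (.join t₁ t₂) ∧ χ t = χ t₁ ∧
      χ t = χ t₂ ∧ χ t ≠ ∅) := by
  have hins : ∀ {A B : Finset α}, A ⊆ B → B.card = A.card + 1 → ∃ a, a ∉ A ∧ B = insert a A := by
    intro A B hAB hc
    obtain ⟨a, ha⟩ := Finset.card_eq_one.1
      (show (B \ A).card = 1 by rw [Finset.card_sdiff_of_subset hAB]; omega)
    refine ⟨a, ?_, ?_⟩
    · have : a ∈ B \ A := by simp [ha]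
      exact (Finset.mem_sdiff.1 this).2
    · rw [← Finset.sdiff_union_of_subset hAB, ha]; rfl
  have h1 := h.has_type t
  have h2 := h.leaf_empty t
  unfold nodeType at h1 h2 ⊢
  rcases hc : T.children t with _ | ⟨t₁, _ | ⟨t₂, _ | ⟨t₃, L⟩⟩⟩ <;> rw [hc] at h1 h2
  · exact Or.inl ⟨rfl, rfl, h2 rfl⟩
  · dsimp only at h1 ⊢
    split_ifs at h1 ⊢ with h3 h4
    · obtain ⟨a, ha⟩ := hins h3.1 h3.2
      exact Or.inr (Or.inl ⟨t₁, a, rfl, rfl, ha⟩)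
    · obtain ⟨a, ha⟩ := hins h4.1 h4.2
      exact Or.inr (Or.inr (Or.inl ⟨t₁, a, rfl, rfl, ha⟩))
    · exact absurd rfl h1
  · dsimp only at h1 ⊢
    split_ifs at h1 ⊢ with h3
    · exact Or.inr (Or.inr (Or.inr ⟨t₁, t₂, rfl, rfl, h3⟩))
    · exact absurd rfl h1
  · exact absurd rfl h1

theorem mem_PHC_leaf {T : OrdTree N} {χ : N → Finset α} {t : N}
    (ht : nodeType T χ t = some .leaf) {bag : Finset α} {P : Program α}
    {L : List (Finset (Row α))} {u : Row α} :
    u ∈ PHC T χ t bag P L ↔ u = (∅, ∅, []) := by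
  simp [PHC, ht]

/-- The table is arbitrary because `PHC` is applied both to full child tables and, in `origins`, to
singletons. -/
theorem mem_PHC_int {T : OrdTree N} {χ : N → Finset α} {t t' : N} {a : α}
    (ht : nodeType T χ t = some (.int t')) (ha : a ∉ χ t') (hχ : χ t = insert a (χ t'))
    {P : Program α} {τ : Finset (Row α)} (hτ : ∀ s ∈ τ, GoodRow (χ t') s) {u : Row α} :
    u ∈ PHC T χ t (χ t) P [τ] ↔ ∃ s ∈ τ, IntroRel P (χ t') (χ t) s u := by
  have hd : χ t \ χ t' = {a} := by
    rw [hχ, Finset.insert_sdiff_of_notMem _ ha, Finset.sdiff_self]; rfl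
  unfold PHC
  rw [ht]
  simp only [hd, Finset.singleton_biUnion, Finset.mem_biUnion, Finset.mem_filter,
    Finset.mem_insert, Finset.mem_singleton, Finset.mem_image]
  refine exists_congr fun s => and_congr_right fun hs => ?_
  rw [hχ, introRel_iff ha (hτ s hs)]
  constructor
  · rintro ⟨J, ⟨hJ, hm⟩, σ, hσ, rfl⟩
    exact ⟨hJ, hm, hσ, rfl⟩
  · rintro ⟨h1, h2, h3, h4⟩
    exact ⟨u.1, ⟨h1, h2⟩, u.2.2, h3, by rw [← h4]⟩

theorem mem_PHC_rem {T : OrdTree N} {χ : N → Finset α} {t t' : N} {a : α}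
    (ht : nodeType T χ t = some (.rem t')) (ha : a ∉ χ t) (hχ : χ t' = insert a (χ t))
    {P : Program α} {τ : Finset (Row α)} {u : Row α} :
    u ∈ PHC T χ t (χ t) P [τ] ↔ ∃ s ∈ τ, RemoveRel a s u := by
  have hd : χ t' \ χ t = {a} := by
    rw [hχ, Finset.insert_sdiff_of_notMem _ ha, Finset.sdiff_self]; rfl
  unfold PHC
  rw [ht]
  simp only [hd, Finset.singleton_biUnion, Finset.mem_filter, Finset.mem_image, RemoveRel,
    and_assoc]
  refine exists_congr fun s => and_congr_right fun hs => and_congr ?_ eq_comm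
  simp

theorem mem_PHC_join {T : OrdTree N} {χ : N → Finset α} {t t₁ t₂ : N}
    (ht : nodeType T χ t = some (.join t₁ t₂)) {bag : Finset α}
    {P : Program α} {τ₁ τ₂ : Finset (Row α)} {u : Row α} :
    u ∈ PHC T χ t bag P [τ₁, τ₂] ↔ ∃ s₁ ∈ τ₁, ∃ s₂ ∈ τ₂, JoinRel s₁ s₂ u := by
  unfold PHC
  rw [ht]
  simp only [Finset.mem_biUnion, Finset.mem_filter, Finset.mem_image, JoinRel, and_assoc]
  refine exists_congr fun s => and_congr_right fun hs => exists_congr fun s' =>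
    and_congr_right fun hs' => and_congr_right fun _ => and_congr_right fun _ => eq_comm

theorem isExtension_node_iff [DecidableEq N] {P : Program α} {T : OrdTree N} {χ : N → Finset α}
    {τ : N → Finset (Row α)} {t : N} (ht : T.children t ≠ []) {u : Row α}
    {X : Finset (N × Row α)} :
    IsExtension P T χ τ t u X ↔ ∃ s ∈ origins P T χ τ t u,
      ∃ Y : Fin (T.children t).length → Finset (N × Row α),
        (∀ i, IsExtension P T χ τ ((T.children t).get i) (s i) (Y i)) ∧
        X = {(t, u)} ∪ Finset.univ.biUnion Y := by
  constructor
  · rintro (⟨_, _, h⟩ | ⟨_, _, h, s, hs, Y, hY⟩)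
    · exact absurd h ht
    · exact ⟨s, hs, Y, hY, rfl⟩
  · rintro ⟨s, hs, Y, hY, rfl⟩
    exact .node t u ht s hs Y hY

variable [Fintype N] [DecidableEq N]

theorem dpPHC_eq (P : Program α) (T : OrdTree N) (χ : N → Finset α) (t : N) :
    dpPHC P T χ t =
      PHC T χ t (χ t) (bagProgram P (χ t)) ((T.children t).map (dpPHC P T χ)) :=
  dynProg_eq _ _ _ _ _

theorem goodRow_of_mem_dpPHC (P : Program α) {T : OrdTree N} {χ : N → Finset α}
    (hn : IsNice T χ) (t : N) : ∀ u ∈ dpPHC P T χ t, GoodRow (χ t) u := by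
  induction t using T.induction with
  | h t ih =>
    intro u hu
    rw [dpPHC_eq] at hu
    rcases hn.cases t with ⟨hc, ht, -⟩ | ⟨t', a, hc, ht, ha, hχ⟩ | ⟨t', a, hc, ht, ha, hχ⟩ |
      ⟨t₁, t₂, hc, ht, h₁, h₂, -⟩
    · obtain rfl := (mem_PHC_leaf ht).1 hu
      exact ⟨Finset.empty_subset _, subset_rfl, List.nodup_nil, rfl⟩
    · have ih' := ih t' (by simp [hc])
      rw [hc, List.map_singleton, mem_PHC_int ht ha hχ ih'] at hu
      obtain ⟨s, hs, hsu⟩ := hu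
      exact hsu.goodRow (ih' s hs)
    · have ih' := ih t' (by simp [hc])
      rw [hc, List.map_singleton, mem_PHC_rem ht ha hχ] at hu
      obtain ⟨s, hs, hsu⟩ := hu
      exact hsu.goodRow (hχ ▸ ih' s hs)
    · rw [hc, List.map_cons, List.map_singleton, mem_PHC_join ht] at hu
      obtain ⟨s₁, hs₁, s₂, hs₂, hsu⟩ := hu
      exact hsu.goodRow (h₁ ▸ ih t₁ (by simp [hc]) s₁ hs₁) (h₂ ▸ ih t₂ (by simp [hc]) s₂ hs₂)

/-- `I` is the interpretation of an extension of `u` below `t`. -/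
def HasExtension (P : Program α) (T : OrdTree N) (χ : N → Finset α) (t : N) (u : Row α)
    (I : Finset α) : Prop :=
  ∃ X, IsExtension P T χ (dpPHC P T χ) t u X ∧ I = X.biUnion fun p => p.2.1

variable {P : Program α} {T : OrdTree N} {χ : N → Finset α}

theorem mem_and_hasExtension_leaf {t : N} (hc : T.children t = [])
    (ht : nodeType T χ t = some .leaf) {u : Row α} {I : Finset α} :
    u ∈ dpPHC P T χ t ∧ HasExtension P T χ t u I ↔ u = (∅, ∅, []) ∧ I = ∅ := by
  rw [dpPHC_eq, mem_PHC_leaf ht]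
  refine and_congr_right fun hu => ?_
  subst hu
  constructor
  · rintro ⟨X, hX, rfl⟩
    rcases hX with _ | ⟨_, _, h⟩
    · simp
    · exact absurd hc h
  · rintro rfl
    exact ⟨_, .leaf t _ hc, by simp⟩

/-- The relation `R` stands for `IntroRel` or `RemoveRel`. Quantifying over all subtables `τ` gives
membership in the table (the full child table) and the origins (singletons) at once. -/
theorem mem_and_hasExtension_one {t t' : N} (hc : T.children t = [t'])
    {R : Row α → Row α → Prop}
    (hR : ∀ τ ⊆ dpPHC P T χ t', ∀ u, u ∈ PHC T χ t (χ t) (bagProgram P (χ t)) [τ] ↔ ∃ s ∈ τ, R s u)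
    {u : Row α} {I : Finset α} :
    u ∈ dpPHC P T χ t ∧ HasExtension P T χ t u I ↔ ∃ s I', (s ∈ dpPHC P T χ t' ∧
      HasExtension P T χ t' s I') ∧ R s u ∧ I = u.1 ∪ I' := by
  have hR' : ∀ s ∈ dpPHC P T χ t', (u ∈ PHC T χ t (χ t) (bagProgram P (χ t)) [{s}] ↔ R s u) := by
    intro s hs
    rw [hR _ (by simpa using hs)]
    simp
  have hmem : u ∈ dpPHC P T χ t ↔ ∃ s ∈ dpPHC P T χ t', R s u := by
    rw [dpPHC_eq, hc, List.map_singleton, hR _ subset_rfl]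
  have hext : ∀ X, IsExtension P T χ (dpPHC P T χ) t u X ↔ ∃ s ∈ dpPHC P T χ t', R s u ∧
      ∃ Y, IsExtension P T χ (dpPHC P T χ) t' s Y ∧ X = {(t, u)} ∪ Y := by
    intro X
    rw [isExtension_node_iff (by simp [hc])]
    simp only [origins, Set.mem_ofPred_eq]
    -- With the list of children replaced by a literal one, its index type becomes `Fin 1`.
    generalize T.children t = L at hc
    subst hc
    constructor
    · rintro ⟨s, ⟨hs, hu⟩, Y, hY, rfl⟩
      refine ⟨s 0, hs 0, (hR' _ (hs 0)).1 hu, Y 0, hY 0, ?_⟩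
      congr 1
      exact Finset.singleton_biUnion
    · rintro ⟨s, hs, hu, Y, hY, rfl⟩
      refine ⟨fun _ => s, ⟨?_, (hR' _ hs).2 hu⟩, fun _ => Y, ?_, ?_⟩
      · exact Fin.forall_fin_one.2 hs
      · exact Fin.forall_fin_one.2 hY
      · congr 1
        exact (Finset.singleton_biUnion (a := (0 : Fin 1)) (t := fun _ => Y)).symm
  constructor
  · rintro ⟨-, X, hX, rfl⟩
    obtain ⟨s, hs, hsu, Y, hY, rfl⟩ := (hext X).1 hX
    exact ⟨s, _, ⟨hs, Y, hY, rfl⟩, hsu, by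
      rw [Finset.union_biUnion, Finset.singleton_biUnion]⟩
  · rintro ⟨s, I', ⟨hs, Y, hY, rfl⟩, hsu, rfl⟩
    refine ⟨hmem.2 ⟨s, hs, hsu⟩, _, (hext _).2 ⟨s, hs, hsu, Y, hY, rfl⟩, ?_⟩
    rw [Finset.union_biUnion, Finset.singleton_biUnion]

theorem mem_and_hasExtension_two {t t₁ t₂ : N} (hc : T.children t = [t₁, t₂])
    (ht : nodeType T χ t = some (.join t₁ t₂)) {u : Row α} {I : Finset α} :
    u ∈ dpPHC P T χ t ∧ HasExtension P T χ t u I ↔ ∃ s₁ I₁ s₂ I₂,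
      (s₁ ∈ dpPHC P T χ t₁ ∧ HasExtension P T χ t₁ s₁ I₁) ∧
      (s₂ ∈ dpPHC P T χ t₂ ∧ HasExtension P T χ t₂ s₂ I₂) ∧
      JoinRel s₁ s₂ u ∧ I = u.1 ∪ (I₁ ∪ I₂) := by
  have hR' : ∀ s₁ s₂, (u ∈ PHC T χ t (χ t) (bagProgram P (χ t)) [{s₁}, {s₂}] ↔
      JoinRel s₁ s₂ u) := by
    intro s₁ s₂
    rw [mem_PHC_join ht]
    simp
  have hmem : u ∈ dpPHC P T χ t ↔
      ∃ s₁ ∈ dpPHC P T χ t₁, ∃ s₂ ∈ dpPHC P T χ t₂, JoinRel s₁ s₂ u := by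
    rw [dpPHC_eq, hc, List.map_cons, List.map_singleton, mem_PHC_join ht]
  have hext : ∀ X, IsExtension P T χ (dpPHC P T χ) t u X ↔
      ∃ s₁ ∈ dpPHC P T χ t₁, ∃ s₂ ∈ dpPHC P T χ t₂, JoinRel s₁ s₂ u ∧
      ∃ Y₁, IsExtension P T χ (dpPHC P T χ) t₁ s₁ Y₁ ∧
      ∃ Y₂, IsExtension P T χ (dpPHC P T χ) t₂ s₂ Y₂ ∧ X = {(t, u)} ∪ (Y₁ ∪ Y₂) := by
    intro X
    rw [isExtension_node_iff (by simp [hc])]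
    simp only [origins, Set.mem_ofPred_eq]
    generalize T.children t = L at hc
    subst hc
    have huniv : ∀ Y : Fin 2 → Finset (N × Row α), Finset.univ.biUnion Y = Y 0 ∪ Y 1 := by
      intro Y
      ext
      simp
    constructor
    · rintro ⟨s, ⟨hs, hu⟩, Y, hY, rfl⟩
      refine ⟨s (0 : Fin 2), hs (0 : Fin 2), s (1 : Fin 2), hs (1 : Fin 2), (hR' _ _).1 hu,
        Y (0 : Fin 2), hY (0 : Fin 2), Y (1 : Fin 2), hY (1 : Fin 2), ?_⟩
      congr 1
      exact huniv Y
    · rintro ⟨s₁, hs₁, s₂, hs₂, hu, Y₁, hY₁, Y₂, hY₂, rfl⟩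
      refine ⟨(![s₁, s₂] : Fin 2 → _), ⟨?_, (hR' _ _).2 hu⟩, (![Y₁, Y₂] : Fin 2 → _), ?_, ?_⟩
      · exact Fin.forall_fin_two.2 ⟨hs₁, hs₂⟩
      · exact Fin.forall_fin_two.2 ⟨hY₁, hY₂⟩
      · congr 1
        exact (huniv ![Y₁, Y₂]).symm
  constructor
  · rintro ⟨-, X, hX, rfl⟩
    obtain ⟨s₁, hs₁, s₂, hs₂, hsu, Y₁, hY₁, Y₂, hY₂, rfl⟩ := (hext X).1 hX
    exact ⟨s₁, _, s₂, _, ⟨hs₁, Y₁, hY₁, rfl⟩, ⟨hs₂, Y₂, hY₂, rfl⟩, hsu, by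
      rw [Finset.union_biUnion, Finset.union_biUnion, Finset.singleton_biUnion]⟩
  · rintro ⟨s₁, I₁, s₂, I₂, ⟨hs₁, Y₁, hY₁, rfl⟩, ⟨hs₂, Y₂, hY₂, rfl⟩, hsu, rfl⟩
    refine ⟨hmem.2 ⟨s₁, hs₁, s₂, hs₂, hsu⟩, _,
      (hext _).2 ⟨s₁, hs₁, s₂, hs₂, hsu, Y₁, hY₁, Y₂, hY₂, rfl⟩, ?_⟩
    rw [Finset.union_biUnion, Finset.union_biUnion, Finset.singleton_biUnion]

/-- Every row has an origin, and following origins ends at the leaves. This turns a row at the root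
into an interpretation, and also applies when `P` contains the rule without atoms. -/
theorem exists_hasExtension (hn : IsNice T χ) (t : N) :
    ∀ u ∈ dpPHC P T χ t, ∃ I, HasExtension P T χ t u I := by
  induction t using T.induction with
  | h t ih =>
    intro u hu
    rcases hn.cases t with ⟨hc, ht, -⟩ | ⟨t', a, hc, ht, ha, hχ⟩ | ⟨t', a, hc, ht, ha, hχ⟩ |
      ⟨t₁, t₂, hc, ht, h₁, h₂, -⟩
    · exact ⟨_, _, .leaf t _ hc, rfl⟩
    · have hg := goodRow_of_mem_dpPHC P hn t'
      have hu' := hu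
      rw [dpPHC_eq, hc, List.map_singleton, mem_PHC_int ht ha hχ hg] at hu'
      obtain ⟨s, hs, hsu⟩ := hu'
      obtain ⟨I', hI'⟩ := ih t' (by simp [hc]) s hs
      exact ⟨_, ((mem_and_hasExtension_one hc fun τ hτ u =>
        mem_PHC_int ht ha hχ fun s hs => hg s (hτ hs)).2 ⟨s, I', ⟨hs, hI'⟩, hsu, rfl⟩).2⟩
    · have hu' := hu
      rw [dpPHC_eq, hc, List.map_singleton, mem_PHC_rem ht ha hχ] at hu'
      obtain ⟨s, hs, hsu⟩ := hu'
      obtain ⟨I', hI'⟩ := ih t' (by simp [hc]) s hs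
      exact ⟨_, ((mem_and_hasExtension_one hc fun τ _ u =>
        mem_PHC_rem ht ha hχ).2 ⟨s, I', ⟨hs, hI'⟩, hsu, rfl⟩).2⟩
    · have hu' := hu
      rw [dpPHC_eq, hc, List.map_cons, List.map_singleton, mem_PHC_join ht] at hu'
      obtain ⟨s₁, hs₁, s₂, hs₂, hsu⟩ := hu'
      obtain ⟨I₁, hI₁⟩ := ih t₁ (by simp [hc]) s₁ hs₁
      obtain ⟨I₂, hI₂⟩ := ih t₂ (by simp [hc]) s₂ hs₂
      exact ⟨_, ((mem_and_hasExtension_two hc ht).2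
        ⟨s₁, I₁, s₂, I₂, ⟨hs₁, hI₁⟩, ⟨hs₂, hI₂⟩, hsu, rfl⟩).2⟩

end Tables

/-! ### Programs and atoms below a node, and how bags separate them. -/

section Below

variable {α N : Type*} [DecidableEq α] [Fintype N] [DecidableEq N]
  {P : Program α} {T : OrdTree N} {χ : N → Finset α}

theorem below_leaf {t : N} (hc : T.children t = []) : below T t = {t} := by
  rw [below, T.postOrder_eq, hc]; rfl

theorem below_one {t t' : N} (hc : T.children t = [t']) : below T t = below T t' ∪ {t} := by
  rw [below, T.postOrder_eq, hc]; simp [below]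

theorem below_two {t t₁ t₂ : N} (hc : T.children t = [t₁, t₂]) :
    below T t = below T t₁ ∪ below T t₂ ∪ {t} := by
  rw [below, T.postOrder_eq, hc]; ext; simp [below]

theorem bagProgram_mono {A B : Finset α} (h : A ⊆ B) : bagProgram P A ⊆ bagProgram P B :=
  Finset.monotone_filter_right _ fun _ _ hr => hr.trans h

theorem programIn_bagProgram (B : Finset α) : ProgramIn (bagProgram P B) B :=
  fun _ hr => (Finset.mem_filter.1 hr).2

theorem self_mem_below (t : N) : t ∈ below T t := (mem_below T t t).2 (.refl T t)

theorem bag_subset_atomsBelow (t : N) : χ t ⊆ atomsBelow T χ t :=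
  Finset.subset_biUnion_of_mem χ (self_mem_below t)

theorem bagProgram_subset_programBelow (t : N) :
    bagProgram P (χ t) ⊆ programBelow P T χ t :=
  Finset.subset_biUnion_of_mem (fun t => bagProgram P (χ t)) (self_mem_below t)

theorem programIn_programBelow (t : N) :
    ProgramIn (programBelow P T χ t) (atomsBelow T χ t) := by
  intro r hr
  obtain ⟨s, hs, hr⟩ := Finset.mem_biUnion.1 hr
  exact (programIn_bagProgram _ r hr).trans (Finset.subset_biUnion_of_mem χ hs)

theorem programBelow_one {t t' : N} (hc : T.children t = [t']) :
    programBelow P T χ t = programBelow P T χ t' ∪ bagProgram P (χ t) := by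
  rw [programBelow, below_one hc, Finset.union_biUnion, Finset.singleton_biUnion]; rfl

theorem atomsBelow_one {t t' : N} (hc : T.children t = [t']) :
    atomsBelow T χ t = atomsBelow T χ t' ∪ χ t := by
  rw [atomsBelow, below_one hc, Finset.union_biUnion, Finset.singleton_biUnion]; rfl

theorem programBelow_two {t t₁ t₂ : N} (hc : T.children t = [t₁, t₂]) (h : χ t = χ t₁) :
    programBelow P T χ t = programBelow P T χ t₁ ∪ programBelow P T χ t₂ := by
  rw [programBelow, below_two hc, Finset.union_biUnion, Finset.union_biUnion,
    Finset.singleton_biUnion, h]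
  exact Finset.union_eq_left.2 <| (bagProgram_subset_programBelow t₁).trans Finset.subset_union_left

theorem atomsBelow_two {t t₁ t₂ : N} (hc : T.children t = [t₁, t₂]) (h : χ t = χ t₁) :
    atomsBelow T χ t = atomsBelow T χ t₁ ∪ atomsBelow T χ t₂ := by
  rw [atomsBelow, below_two hc, Finset.union_biUnion, Finset.union_biUnion,
    Finset.singleton_biUnion, h]
  exact Finset.union_eq_left.2 <| (bag_subset_atomsBelow t₁).trans Finset.subset_union_left

section Separation

variable {V : Finset α} {G : SimpleGraph α}

/-- Together with its counterpart for siblings, this is what the gluing lemmas need from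
connectedness. -/
theorem IsTreeDecomposition.atomsBelow_inter_bag (h : IsTreeDecomposition V G T χ) {t t' : N}
    (hc : T.IsChild t t') : atomsBelow T χ t' ∩ χ t ⊆ χ t' := by
  intro a ha
  rw [Finset.mem_inter] at ha
  obtain ⟨s, hs, has⟩ := Finset.mem_biUnion.1 ha.1
  exact h.mem_bag_of_separated ((mem_below T t' s).1 hs) (OrdTree.not_isBelow_parent hc) has ha.2

theorem IsTreeDecomposition.atomsBelow_inter_atomsBelow (h : IsTreeDecomposition V G T χ)
    {t t₁ t₂ : N} (h₁ : T.IsChild t t₁) (h₂ : T.IsChild t t₂) (hne : t₁ ≠ t₂) :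
    atomsBelow T χ t₁ ∩ atomsBelow T χ t₂ ⊆ χ t₁ := by
  intro a ha
  rw [Finset.mem_inter] at ha
  obtain ⟨s₁, hs₁, ha₁⟩ := Finset.mem_biUnion.1 ha.1
  obtain ⟨s₂, hs₂, ha₂⟩ := Finset.mem_biUnion.1 ha.2
  rw [mem_below] at hs₁ hs₂
  exact h.mem_bag_of_separated hs₁
    (OrdTree.not_isBelow_sibling h₂ h₁ hne.symm hs₂) ha₁ ha₂

end Separation

end Below

/-! ### Gluing partial solutions at introduce, removal and join nodes. -/

section Gluing

variable {α : Type*} [DecidableEq α]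

/-- A proof is a single rule, so it lives in one of the two parts. The proven atom then belongs to
the atoms of that part, where `B` is no larger than the bag of the part. -/
theorem proven_union_inter {P₁ P₂ : Program α} {A₁ A₂ B₁ B₂ B I : Finset α} {σ : List α}
    (h₁ : ProgramIn P₁ A₁) (h₂ : ProgramIn P₂ A₂) (hB₁ : B₁ ⊆ B) (hB₂ : B₂ ⊆ B)
    (hBA₁ : B ∩ A₁ ⊆ B₁) (hBA₂ : B ∩ A₂ ⊆ B₂) (b : α) :
    (b ∈ B ∧ Proven (P₁ ∪ P₂) I σ b) ↔
      (b ∈ B₁ ∧ Proven P₁ (I ∩ A₁) (σ.filter (· ∈ A₁)) b) ∨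
      (b ∈ B₂ ∧ Proven P₂ (I ∩ A₂) (σ.filter (· ∈ A₂)) b) := by
  rw [proven_inter h₁, proven_inter h₂, proven_union]
  constructor
  · rintro ⟨hb, h | h⟩
    · exact Or.inl ⟨hBA₁ (Finset.mem_inter.2 ⟨hb, h.mem_of_programIn h₁⟩), h⟩
    · exact Or.inr ⟨hBA₂ (Finset.mem_inter.2 ⟨hb, h.mem_of_programIn h₂⟩), h⟩
  · rintro (⟨hb, h⟩ | ⟨hb, h⟩)
    · exact ⟨hB₁ hb, Or.inl h⟩
    · exact ⟨hB₂ hb, Or.inr h⟩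

theorem filter_filter_of_subset {A B : Finset α} (h : B ⊆ A) (σ : List α) :
    (σ.filter (· ∈ A)).filter (· ∈ B) = σ.filter (· ∈ B) := by
  rw [List.filter_filter]
  refine List.filter_congr fun a _ => ?_
  by_cases hb : a ∈ B
  · simp [hb, h hb]
  · simp [hb]

theorem IsOrdering.filter_congr {σ : List α} {I A B : Finset α} (h : IsOrdering σ I)
    (hAB : I ∩ A = I ∩ B) : σ.filter (· ∈ A) = σ.filter (· ∈ B) := by
  refine List.filter_congr fun a ha => ?_
  have := congrArg (a ∈ ·) hAB
  simpa [h.mem_iff.1 ha] using this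

theorem inter_eq_inter_of_subset {A B B' X : Finset α} (hX : X ⊆ A) (hAB : A ∩ B ⊆ B')
    (hB : B' ⊆ B) : X ∩ B = X ∩ B' :=
  (Finset.subset_inter Finset.inter_subset_left
    ((Finset.inter_subset_inter hX subset_rfl).trans hAB)).antisymm
    (Finset.inter_subset_inter subset_rfl hB)

/-- Orderings of two sets that agree on the common atoms have a common extension. -/
theorem exists_common_ordering {A₁ A₂ I₁ I₂ : Finset α} {σ₁ σ₂ : List α}
    (h₁ : IsOrdering σ₁ I₁) (h₂ : IsOrdering σ₂ I₂) (hI₁ : I₁ ⊆ A₁) (hI₂ : I₂ ⊆ A₂)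
    (h : σ₁.filter (· ∈ A₂) = σ₂.filter (· ∈ A₁)) :
    ∃ σ, IsOrdering σ (I₁ ∪ I₂) ∧ (I₁ ∪ I₂) ∩ A₁ = I₁ ∧ (I₁ ∪ I₂) ∩ A₂ = I₂ ∧
      σ.filter (· ∈ A₁) = σ₁ ∧ σ.filter (· ∈ A₂) = σ₂ := by
  obtain ⟨σ, hd, hm, e₁, e₂⟩ := exists_merge A₁ A₂ _ σ₁ σ₂ rfl h₁.1 h₂.1
    (fun a ha => hI₁ (h₁.mem_iff.1 ha)) (fun a ha => hI₂ (h₂.mem_iff.1 ha)) h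
  have hσ : IsOrdering σ (I₁ ∪ I₂) := isOrdering_iff.2 ⟨hd, fun a => by
    rw [hm, h₁.mem_iff, h₂.mem_iff, Finset.mem_union]⟩
  refine ⟨σ, hσ, ?_, ?_, e₁, e₂⟩
  · rw [← (hσ.filter A₁).2, e₁, h₁.2]
  · rw [← (hσ.filter A₂).2, e₂, h₂.2]

/-- Gluing at an introduce node. -/
theorem exists_isTrace_intro_iff {P' Q : Program α} {A B' B : Finset α}
    (hP' : ProgramIn P' A) (hQ : ProgramIn Q B) (hB'A : B' ⊆ A) (hB' : B' ⊆ B)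
    (hAB : A ∩ B ⊆ B') {u : Row α} {I : Finset α} :
    (∃ s I', (∃ σ, IsSolution P' A B' I' σ ∧ IsTrace P' B' I' σ s) ∧ IntroRel Q B' B s u ∧
      I = u.1 ∪ I') ↔
    ∃ σ, IsSolution (P' ∪ Q) (A ∪ B) B I σ ∧ IsTrace (P' ∪ Q) B I σ u := by
  have hBA : B ∩ A ⊆ B' := Finset.inter_comm A B ▸ hAB
  constructor
  · rintro ⟨s, I', ⟨σ', hsol, htr⟩, hR, rfl⟩
    -- The common atoms lie in `B'`, and on `B'` both orderings restrict to the sequence of the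
    -- child row `s`.
    have hfilter : σ'.filter (· ∈ B) = u.2.2.filter (· ∈ A) := by
      rw [hsol.ordering.filter_congr (inter_eq_inter_of_subset hsol.subset hAB hB'), ← htr.seq, ← hR.seq]
      exact hR.ordering.filter_congr (inter_eq_inter_of_subset hR.subset hBA hB'A).symm
    obtain ⟨σ, hσ, eA, eB, fA, fB⟩ :=
      exists_common_ordering hsol.ordering hR.ordering hsol.subset hR.subset hfilter
    rw [Finset.union_comm u.1]
    refine ⟨σ, (isSolution_union hP' hQ (Finset.union_subset_union hsol.subset hR.subset) hσ hAB
      Finset.inter_subset_right hB' subset_rfl hBA Finset.inter_subset_left).2 ⟨?_, ?_⟩,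
      eB.symm, fun b => ?_, fB.symm⟩
    · rwa [eA, fA]
    · rw [eB, fB]
      -- The part added at an introduce node has no atoms outside the bag, so nothing in it has to
      -- be proven.
      exact ⟨hR.subset, hR.ordering, hR.model, fun a ha hb => absurd (hR.subset ha) hb⟩
    · rw [proven_union_inter hP' hQ hB' subset_rfl hBA Finset.inter_subset_left, eA, eB, fA, fB,
        hR.proven, htr.proven]
      exact or_congr_right ⟨fun h => ⟨hR.subset h.mem, h⟩, fun h => h.2⟩
  · rintro ⟨σ, hsol, htr⟩
    obtain ⟨h₁, h₂⟩ := (isSolution_union hP' hQ hsol.subset hsol.ordering hAB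
      Finset.inter_subset_right hB' subset_rfl hBA Finset.inter_subset_left).1 hsol
    obtain ⟨s, hs⟩ := exists_isTrace P' B' (I ∩ A) (σ.filter (· ∈ A))
    refine ⟨s, _, ⟨_, h₁, hs⟩, ⟨?_, ?_, ?_, ?_, ?_, fun b => ?_⟩, ?_⟩
    · rw [htr.interp]; exact Finset.inter_subset_right
    · rw [htr.interp, hs.interp, Finset.inter_assoc, Finset.inter_assoc,
        Finset.inter_eq_right.2 hB', Finset.inter_eq_right.2 hB'A]
    · rw [htr.interp, htr.seq]; exact h₂.ordering
    · rw [htr.seq, hs.seq, filter_filter_of_subset hB', filter_filter_of_subset hB'A]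
    · rw [htr.interp]; exact h₂.model
    · rw [htr.proven, hs.proven, htr.interp, htr.seq,
        proven_union_inter hP' hQ hB' subset_rfl hBA Finset.inter_subset_left]
      exact or_congr_right ⟨fun h => h.2, fun h => ⟨(Finset.mem_inter.1 h.mem).2, h⟩⟩
    · rw [htr.interp, ← Finset.inter_union_distrib_left, Finset.union_comm,
        Finset.inter_eq_left.2 hsol.subset]

theorem IsTrace.remove {P : Program α} {B I : Finset α} {a : α} (ha : a ∉ B) {σ : List α}
    {s : Row α} (hσ : IsOrdering σ I) (h : IsTrace P (insert a B) I σ s) :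
    IsTrace P B I σ (s.1.erase a, s.2.1.erase a, s.2.2.erase a) := by
  have key : ∀ b, b ∈ B ↔ b ≠ a ∧ b ∈ insert a B := fun b => by
    rw [← Finset.mem_erase, Finset.erase_insert ha]
  refine ⟨?_, fun b => ?_, ?_⟩
  · ext b
    simp only [Finset.mem_erase, h.interp, Finset.mem_inter, key b]
    tauto
  · simp only [Finset.mem_erase, h.proven, key b]
    tauto
  · dsimp only
    rw [h.seq, (hσ.1.filter _).erase_eq_filter, List.filter_filter]
    refine List.filter_congr fun b _ => ?_
    rw [Bool.eq_iff_iff]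
    simp only [Bool.and_eq_true, bne_iff_ne, decide_eq_true_eq, key b]

/-- Passing to a smaller bag at a removal node. -/
theorem exists_isTrace_remove_iff {P : Program α} {A B : Finset α} {a : α} (ha : a ∉ B)
    {u : Row α} {I : Finset α} :
    (∃ s I', (∃ σ, IsSolution P A (insert a B) I' σ ∧ IsTrace P (insert a B) I' σ s) ∧
      RemoveRel a s u ∧ I = u.1 ∪ I') ↔
    ∃ σ, IsSolution P A B I σ ∧ IsTrace P B I σ u := by
  constructor
  · rintro ⟨s, I', ⟨σ, hsol, htr⟩, ⟨hR, rfl⟩, rfl⟩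
    have hs : s.1.erase a ∪ I' = I' := by
      rw [Finset.union_eq_right, htr.interp]
      exact (Finset.erase_subset _ _).trans Finset.inter_subset_left
    rw [hs]
    refine ⟨σ, ⟨hsol.subset, hsol.ordering, hsol.model, fun b hb hbB => ?_⟩,
      htr.remove ha hsol.ordering⟩
    -- Only `a` newly leaves the bag, and the condition on the row at a removal node says that it is
    -- proven or false.
    by_cases hba : b = a
    · subst hba
      rcases hR with hR | hR
      · exact ((htr.proven _).1 hR).2
      · refine absurd ?_ hR
        rw [htr.interp]
        exact Finset.mem_inter.2 ⟨hb, Finset.mem_insert_self _ _⟩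
    · exact hsol.proven b hb (by simp [hba, hbB])
  · rintro ⟨σ, hsol, htr⟩
    obtain ⟨s, hs⟩ := exists_isTrace P (insert a B) I σ
    refine ⟨s, I, ⟨σ, ⟨hsol.subset, hsol.ordering, hsol.model, fun b hb hbB =>
      hsol.proven b hb fun h => hbB (Finset.mem_insert_of_mem h)⟩, hs⟩,
      ⟨?_, htr.unique (hs.remove ha hsol.ordering)⟩, ?_⟩
    · by_cases haI : a ∈ I
      · exact Or.inl ((hs.proven a).2 ⟨Finset.mem_insert_self _ _, hsol.proven a haI ha⟩)
      · refine Or.inr fun h => haI ?_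
        rw [hs.interp] at h
        exact (Finset.mem_inter.1 h).1
    · rw [htr.interp, Finset.union_eq_right.2 Finset.inter_subset_left]

/-- Gluing at a join node. -/
theorem exists_isTrace_join_iff {P₁ P₂ : Program α} {A₁ A₂ B : Finset α}
    (h₁ : ProgramIn P₁ A₁) (h₂ : ProgramIn P₂ A₂) (hB₁ : B ⊆ A₁) (hB₂ : B ⊆ A₂)
    (hA : A₁ ∩ A₂ ⊆ B) {u : Row α} {I : Finset α} :
    (∃ s₁ I₁ s₂ I₂, (∃ σ, IsSolution P₁ A₁ B I₁ σ ∧ IsTrace P₁ B I₁ σ s₁) ∧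
      (∃ σ, IsSolution P₂ A₂ B I₂ σ ∧ IsTrace P₂ B I₂ σ s₂) ∧ JoinRel s₁ s₂ u ∧
      I = u.1 ∪ (I₁ ∪ I₂)) ↔
    ∃ σ, IsSolution (P₁ ∪ P₂) (A₁ ∪ A₂) B I σ ∧ IsTrace (P₁ ∪ P₂) B I σ u := by
  constructor
  · rintro ⟨s₁, I₁, s₂, I₂, ⟨σ₁, hsol₁, htr₁⟩, ⟨σ₂, hsol₂, htr₂⟩, ⟨hs, hs', rfl⟩, rfl⟩
    have e₁ := inter_eq_inter_of_subset hsol₁.subset hA hB₂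
    have e₂ := inter_eq_inter_of_subset hsol₂.subset (Finset.inter_comm A₁ A₂ ▸ hA) hB₁
    -- All common atoms lie in `B`, where both orderings restrict to the sequence shared by the two
    -- rows.
    have hfilter : σ₁.filter (· ∈ A₂) = σ₂.filter (· ∈ A₁) := by
      rw [hsol₁.ordering.filter_congr e₁, hsol₂.ordering.filter_congr e₂, ← htr₁.seq, ← htr₂.seq,
        hs']
    obtain ⟨σ, hσ, eA, eB, fA, fB⟩ :=
      exists_common_ordering hsol₁.ordering hsol₂.ordering hsol₁.subset hsol₂.subset hfilter
    have hu : s₁.1 ∪ (I₁ ∪ I₂) = I₁ ∪ I₂ := by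
      rw [Finset.union_eq_right, htr₁.interp]
      exact Finset.inter_subset_left.trans Finset.subset_union_left
    dsimp only
    rw [hu]
    refine ⟨σ, (isSolution_union h₁ h₂ (Finset.union_subset_union hsol₁.subset hsol₂.subset) hσ hA
      hA subset_rfl subset_rfl Finset.inter_subset_left Finset.inter_subset_left).2 ⟨?_, ?_⟩,
      ?_, fun b => ?_, ?_⟩
    · rwa [eA, fA]
    · rwa [eB, fB]
    · dsimp only
      rw [Finset.union_inter_distrib_right, ← htr₁.interp, ← htr₂.interp, hs, Finset.union_self]
    · rw [proven_union_inter h₁ h₂ subset_rfl subset_rfl Finset.inter_subset_left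
        Finset.inter_subset_left, eA, eB, fA, fB, Finset.mem_union, htr₁.proven, htr₂.proven]
    · dsimp only
      rw [htr₁.seq, ← fA, filter_filter_of_subset hB₁]
  · rintro ⟨σ, hsol, htr⟩
    obtain ⟨h₁', h₂'⟩ := (isSolution_union h₁ h₂ hsol.subset hsol.ordering hA
      hA subset_rfl subset_rfl Finset.inter_subset_left Finset.inter_subset_left).1 hsol
    obtain ⟨s₁, hs₁⟩ := exists_isTrace P₁ B (I ∩ A₁) (σ.filter (· ∈ A₁))
    obtain ⟨s₂, hs₂⟩ := exists_isTrace P₂ B (I ∩ A₂) (σ.filter (· ∈ A₂))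
    have i₁ := hs₁.interp
    have i₂ := hs₂.interp
    have f₁ := hs₁.seq
    have f₂ := hs₂.seq
    rw [Finset.inter_assoc, Finset.inter_eq_right.2 hB₁] at i₁
    rw [Finset.inter_assoc, Finset.inter_eq_right.2 hB₂] at i₂
    rw [filter_filter_of_subset hB₁] at f₁
    rw [filter_filter_of_subset hB₂] at f₂
    refine ⟨s₁, _, s₂, _, ⟨_, h₁', hs₁⟩, ⟨_, h₂', hs₂⟩, ⟨i₂.trans i₁.symm, f₂.trans f₁.symm,
      htr.unique ⟨i₁, fun b => ?_, f₁⟩⟩, ?_⟩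
    · rw [proven_union_inter h₁ h₂ subset_rfl subset_rfl Finset.inter_subset_left
        Finset.inter_subset_left, Finset.mem_union, hs₁.proven, hs₂.proven]
    · rw [htr.interp, ← Finset.inter_union_distrib_left, Finset.inter_eq_left.2 hsol.subset,
        Finset.union_eq_right.2 Finset.inter_subset_left]

end Gluing

/-! ### Correctness at every node, then at the root. -/

section Correctness

variable {α N : Type*} [DecidableEq α] [Fintype N] [DecidableEq N]
  {P : Program α} {T : OrdTree N} {χ : N → Finset α}

/-- The rows in the table of `t` together with the interpretations of their extensions are
exactly the traces of the solutions up to `t`. -/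
theorem mem_and_hasExtension_iff (hP : Rule.empty ∉ P) {V : Finset α} {G : SimpleGraph α}
    (hT : IsTreeDecomposition V G T χ) (hn : IsNice T χ) (t : N) : ∀ u I,
      (u ∈ dpPHC P T χ t ∧ HasExtension P T χ t u I) ↔
        ∃ σ, IsSolution (programBelow P T χ t) (atomsBelow T χ t) (χ t) I σ ∧
          IsTrace (programBelow P T χ t) (χ t) I σ u := by
  induction t using T.induction with
  | h t ih =>
    intro u I
    rcases hn.cases t with ⟨hc, ht, hχ⟩ | ⟨t', a, hc, ht, ha, hχ⟩ | ⟨t', a, hc, ht, ha, hχ⟩ |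
      ⟨t₁, t₂, hc, ht, h₁, h₂, -⟩
    · rw [mem_and_hasExtension_leaf hc ht]
      have hA : atomsBelow T χ t = ∅ := by rw [atomsBelow, below_leaf hc]; simpa using hχ
      -- Only the rule without atoms fits into the empty bag of a leaf; its absence makes the
      -- program below the leaf empty.
      have hPt : programBelow P T χ t = ∅ := by
        rw [programBelow, below_leaf hc, Finset.singleton_biUnion, hχ,
          Finset.eq_empty_iff_forall_notMem]
        intro r hr
        obtain ⟨hr, h⟩ := Finset.mem_filter.1 hr
        exact hP (Rule.eq_empty_of_atoms (Finset.subset_empty.1 h) ▸ hr)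
      rw [hA, hPt, hχ]
      have htr : IsTrace (∅ : Program α) ∅ ∅ [] (∅, ∅, []) := ⟨rfl, by simp, rfl⟩
      constructor
      · rintro ⟨rfl, rfl⟩
        exact ⟨[], ⟨subset_rfl, ⟨List.nodup_nil, rfl⟩, by simp [IsModel], by simp⟩, htr⟩
      · rintro ⟨σ, hsol, hu⟩
        obtain rfl := Finset.subset_empty.1 hsol.subset
        obtain rfl : σ = [] := List.eq_nil_iff_forall_not_mem.2 fun a ha => by
          simpa using hsol.ordering.mem_iff.1 ha
        exact ⟨hu.unique htr, rfl⟩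
    · have hg := goodRow_of_mem_dpPHC P hn t'
      have hc' : T.IsChild t t' := by simp [OrdTree.IsChild, hc]
      rw [mem_and_hasExtension_one hc fun τ hτ u =>
        mem_PHC_int ht ha hχ fun s hs => hg s (hτ hs)]
      simp only [ih t' hc']
      rw [programBelow_one hc, atomsBelow_one hc]
      exact exists_isTrace_intro_iff (programIn_programBelow t') (programIn_bagProgram _)
        (bag_subset_atomsBelow t') (hχ ▸ Finset.subset_insert _ _) (hT.atomsBelow_inter_bag hc')
    · have hc' : T.IsChild t t' := by simp [OrdTree.IsChild, hc]
      have hsub : χ t ⊆ χ t' := hχ ▸ Finset.subset_insert _ _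
      rw [mem_and_hasExtension_one hc fun τ _ u => mem_PHC_rem ht ha hχ]
      simp only [ih t' hc']
      rw [programBelow_one hc, atomsBelow_one hc, Finset.union_eq_left.2
        ((bagProgram_mono hsub).trans (bagProgram_subset_programBelow t')), Finset.union_eq_left.2
        (hsub.trans (bag_subset_atomsBelow t')), hχ]
      exact exists_isTrace_remove_iff ha
    · have hc₁ : T.IsChild t t₁ := by simp [OrdTree.IsChild, hc]
      have hc₂ : T.IsChild t t₂ := by simp [OrdTree.IsChild, hc]
      have hne : t₁ ≠ t₂ := by
        have := T.nodup_children t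
        rw [hc] at this
        simpa using this
      rw [mem_and_hasExtension_two hc ht]
      simp only [ih t₁ hc₁, ih t₂ hc₂]
      rw [programBelow_two hc h₁, atomsBelow_two hc h₁, ← h₁, ← h₂]
      exact exists_isTrace_join_iff (programIn_programBelow t₁) (programIn_programBelow t₂)
        (h₁ ▸ bag_subset_atomsBelow t₁) (h₂ ▸ bag_subset_atomsBelow t₂)
        (h₁ ▸ hT.atomsBelow_inter_atomsBelow hc₁ hc₂ hne)

/-- If the program contains the rule without atoms, then the tables above a nonempty bag are
empty. -/
theorem dpPHC_eq_empty (hP : Rule.empty ∈ P) (hn : IsNice T χ) (t : N)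
    (ht : (atomsBelow T χ t).Nonempty) : dpPHC P T χ t = ∅ := by
  induction t using T.induction with
  | h t ih =>
    rw [Finset.eq_empty_iff_forall_notMem]
    intro u hu
    rw [dpPHC_eq] at hu
    rcases hn.cases t with ⟨hc, -, hχ⟩ | ⟨t', a, hc, ht', ha, hχ⟩ | ⟨t', a, hc, ht', ha, hχ⟩ |
      ⟨t₁, t₂, hc, ht', h₁, -, hne⟩
    · rw [atomsBelow, below_leaf hc, Finset.singleton_biUnion, hχ] at ht
      exact Finset.not_nonempty_empty ht
    · rw [hc, List.map_singleton, mem_PHC_int ht' ha hχ (goodRow_of_mem_dpPHC P hn t')] at hu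
      obtain ⟨s, -, hsu⟩ := hu
      -- The rule without atoms belongs to every bag-program, so the model check at an introduce
      -- node rejects every row; removal and join nodes pass the empty table on.
      exact Rule.not_sat_empty _ (hsu.model _
        (Finset.mem_filter.2 ⟨hP, by simp [Rule.atoms, Rule.empty]⟩))
    · rw [hc, List.map_singleton, mem_PHC_rem ht' ha hχ, ih t' (by simp [hc])
        ⟨a, bag_subset_atomsBelow t' (hχ ▸ Finset.mem_insert_self _ _)⟩] at hu
      simp at hu
    · rw [hc, List.map_cons, List.map_singleton, mem_PHC_join ht', ih t₁ (by simp [hc]) (Finset.Nonempty.mono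
        (h₁ ▸ bag_subset_atomsBelow t₁) (Finset.nonempty_iff_ne_empty.2 hne))] at hu
      simp at hu

theorem atomsBelow_root {V : Finset α} {G : SimpleGraph α} (hT : IsTreeDecomposition V G T χ) :
    atomsBelow T χ T.root = V := by
  refine (Finset.biUnion_subset.2 fun t _ => hT.bag_subset t).antisymm fun v hv => ?_
  obtain ⟨t, ht⟩ := hT.cover_vertex v hv
  exact Finset.mem_biUnion.2 ⟨t, (mem_below _ _ _).2 (T.isBelow_root t), ht⟩

/-- The atoms of a rule form a clique of the primal graph and so lie in a common bag. -/
theorem programBelow_root (hT : IsTreeDecomposition P.atoms (primalGraph P) T χ) :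
    programBelow P T χ T.root = P := by
  refine (Finset.biUnion_subset.2 fun t _ => Finset.filter_subset _ _).antisymm fun r hr => ?_
  obtain ⟨t, ht⟩ := hT.exists_bag_of_clique (Finset.subset_biUnion_of_mem Rule.atoms hr)
    fun u hu v hv huv => ⟨huv, r, hr, hu, hv⟩
  exact Finset.mem_biUnion.2 ⟨t, (mem_below _ _ _).2 (T.isBelow_root t),
    Finset.mem_filter.2 ⟨hr, ht⟩⟩

/-- The set of proven atoms is determined by `I` and the ordering, so it can be eliminated. -/
theorem exists_isPHCSolution_iff {t : N} {I : Finset α} :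
    (∃ Q σ, IsPHCSolution P T χ t I Q σ) ↔
      ∃ σ, IsSolution (programBelow P T χ t) (atomsBelow T χ t) (χ t) I σ := by
  classical
  constructor
  · rintro ⟨Q, σ, h⟩
    exact ⟨σ, h.subset_atoms, h.ordering, h.model, fun a ha hb => (h.mem_iff a).1
      (h.strictly_below a (by simp [ha, hb, h.subset_atoms ha]))⟩
  · rintro ⟨σ, h⟩
    refine ⟨I.filter (Proven (programBelow P T χ t) I σ), σ, h.subset, Finset.filter_subset _ _,
      h.ordering, h.model, fun a ha => ?_, fun a => ?_⟩
    · simp only [Finset.mem_inter, Finset.mem_sdiff] at ha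
      exact Finset.mem_filter.2 ⟨ha.1, h.proven a ha.1 ha.2.2⟩
    · rw [Finset.mem_filter]
      exact ⟨fun h => h.2, fun h => ⟨h.mem, h⟩⟩

theorem exists_isPHCSolution_root_iff (hP : HeadCycleFree P)
    (hT : IsTreeDecomposition P.atoms (primalGraph P) T χ) (hn : IsNice T χ) {I : Finset α} :
    (∃ Q σ, IsPHCSolution P T χ T.root I Q σ) ↔ IsAnswerSet P I := by
  rw [exists_isPHCSolution_iff, programBelow_root hT, atomsBelow_root hT, hn.root_empty]
  constructor
  · rintro ⟨σ, h⟩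
    exact isAnswerSet_of_proven h.ordering h.model fun a ha => h.proven a ha (by simp)
  · intro h
    obtain ⟨σ, hσ, hp⟩ := h.exists_ordering hP
    exact ⟨σ, h.subset_atoms hP, hσ, isModel_reduct_self.1 h.1, fun a ha _ => hp a ha⟩

theorem mem_interpretations_iff {t : N} {I : Finset α} :
    I ∈ interpretations (extensions P T χ (dpPHC P T χ) t (dpPHC P T χ t)) ↔
      ∃ u ∈ dpPHC P T χ t, HasExtension P T χ t u I := by
  constructor
  · rintro ⟨X, ⟨u, hu, hX⟩, rfl⟩
    exact ⟨u, hu, X, hX, rfl⟩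
  · rintro ⟨u, hu, X, hX, rfl⟩
    exact ⟨X, ⟨u, hu, hX⟩, rfl⟩

/-- If `P` contains the rule without atoms, it has another rule and hence an atom; then the root
table is empty and there is no model, so both sides are empty. Otherwise `mem_and_hasExtension_iff`
applies at the root. -/
theorem interpretations_root (hne : P ≠ {Rule.empty})
    (hT : IsTreeDecomposition P.atoms (primalGraph P) T χ) (hn : IsNice T χ) :
    interpretations (extensions P T χ (dpPHC P T χ) T.root (dpPHC P T χ T.root)) =
      {I | ∃ Q σ, IsPHCSolution P T χ T.root I Q σ} := by
  ext I
  rw [mem_interpretations_iff, Set.mem_ofPred_eq, exists_isPHCSolution_iff]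
  by_cases hP : Rule.empty ∈ P
  · have hatoms : P.atoms.Nonempty := by
      rw [Finset.nonempty_iff_ne_empty]
      intro h
      refine hne (Finset.eq_singleton_iff_unique_mem.2 ⟨hP, fun r hr => ?_⟩)
      refine Rule.eq_empty_of_atoms (Finset.subset_empty.1 ?_)
      exact h ▸ Finset.subset_biUnion_of_mem Rule.atoms hr
    rw [dpPHC_eq_empty hP hn T.root (by rwa [atomsBelow_root hT])]
    refine iff_of_false (by simp) ?_
    rintro ⟨σ, h⟩
    rw [programBelow_root hT] at h
    exact Rule.not_sat_empty _ (h.model _ hP)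
  · constructor
    · rintro ⟨u, hu⟩
      obtain ⟨σ, h, -⟩ := (mem_and_hasExtension_iff hP hT hn T.root u I).1 hu
      exact ⟨σ, h⟩
    · rintro ⟨σ, h⟩
      obtain ⟨u, hu⟩ := exists_isTrace (programBelow P T χ T.root) (χ T.root) I σ
      exact ⟨u, (mem_and_hasExtension_iff hP hT hn T.root u I).2 ⟨σ, h, hu⟩⟩

theorem eq_of_goodRow_empty {u : Row α} (h : GoodRow ∅ u) : u = (∅, ∅, []) := by
  obtain ⟨I, Q, σ⟩ := u
  obtain ⟨h1, h2, h3⟩ := h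
  dsimp only at h1 h2 h3
  obtain rfl := Finset.subset_empty.1 h1
  obtain rfl := Finset.subset_empty.1 h2
  obtain rfl : σ = [] := List.toFinset_eq_empty_iff σ |>.1 h3.2
  rfl

end Correctness

end ASP

theorem theorem2 {α N : Type*} [DecidableEq α] [Fintype N] [DecidableEq N]
    (P : ASP.Program α) (hP : ASP.HeadCycleFree P) (hne : P ≠ {ASP.Rule.empty})
    (T : ASP.OrdTree N) (χ : N → Finset α)
    (hTD : ASP.IsTreeDecomposition P.atoms (ASP.primalGraph P) T χ)
    (hnice : ASP.IsNice T χ) :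
    let τ : N → Finset (ASP.Row α) := ASP.dpPHC P T χ
    (∀ t, ∀ u ∈ τ t, u.1 ⊆ χ t ∧ u.2.1 ⊆ u.1 ∧ ASP.IsOrdering u.2.2 u.1) ∧
    ((∃ I, ASP.IsAnswerSet P I) ↔ ((∅, ∅, []) : ASP.Row α) ∈ τ T.root) ∧
    ASP.interpretations (ASP.extensions P T χ τ T.root (τ T.root)) =
      {I | ∃ Q σ, ASP.IsPHCSolution P T χ T.root I Q σ} ∧
    {I | ∃ Q σ, ASP.IsPHCSolution P T χ T.root I Q σ} = {I | ASP.IsAnswerSet P I} := by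
  intro τ
  have hgood := ASP.goodRow_of_mem_dpPHC P hnice
  have hint := ASP.interpretations_root hne hTD hnice
  have hans : {I | ∃ Q σ, ASP.IsPHCSolution P T χ T.root I Q σ} = {I | ASP.IsAnswerSet P I} :=
    Set.ext fun I => ASP.exists_isPHCSolution_root_iff hP hTD hnice
  refine ⟨hgood, ⟨?_, fun h => ?_⟩, hint, hans⟩
  · rintro ⟨I, hI⟩
    have hmem : I ∈ {I | ASP.IsAnswerSet P I} := hI
    rw [← hans, ← hint, ASP.mem_interpretations_iff] at hmem
    obtain ⟨u, hu, -⟩ := hmem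
    -- The bag of the root is empty, so the row found there can only be the empty one.
    exact ASP.eq_of_goodRow_empty (hnice.root_empty ▸ hgood T.root u hu) ▸ hu
  · obtain ⟨I, hI⟩ := ASP.exists_hasExtension hnice T.root _ h
    have hmem := ASP.mem_interpretations_iff.2 ⟨_, h, hI⟩
    rw [hint, hans] at hmem
    exact ⟨I, hmem⟩
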